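/- Fix an integer $p \ge 3$. For $\beta\in\mathbb R$, $h \in \mathbb{R}$ and $N\ge 1$ let $\mathbb{P}_{\beta,h,p}$ be the $p$-tensor Curie–Weiss model on $\{-1,1\}^N$, $$\mathbb{P}_{\beta,h,p}(\boldsymbol X) = \frac{1}{2^N Z_N(\beta,h,p)} \exp\Big\{ \frac{\beta}{N^{p-1}} \sum_{1\le i_1,\dots,i_p\le N} X_{i_1}\cdots X_{i_p} + h \sum_{i=1}^N X_i \Big\},$$ where $Z_N(\beta,h,p)$ is the normalizing constant. For $x\in[-1,1]$ put $H(x)=H_{\beta,h,p}(x) := \beta x^p + hx - \frac12\{(1+x)\log(1+x)+(1-x)\log(1-x)\}$ (with $0\log 0=0$). A point $(\beta,h)\in[0,\infty)\times\mathbb{R}$ is called $p$-special if $H$ has a unique global maximizer $m_*$ on $[-1,1]$, $m_*\in(-1,1)$, and $H''(m_*)=0$. Let $(\beta,h)$ be $p$-special with maximizer $m_*$, assume that $h$ is known and $\boldsymbol X\sim\mathbb{P}_{\beta,h,p}$, and let $\hat\beta_N\in[-\infty,\infty]$ be a maximum likelihood estimate of $\beta$: a real maximizer of $\beta'\mapsto\mathbb{P}_{\beta',h,p}(\boldsymbol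 X)$ over $\mathbb{R}$, or $\hat\beta_N=\pm\infty$ if the supremum of this function is its limit at $\pm\infty$. For $t\in\mathbb{R}$ let $F_{t,0}$ be the probability law on $\mathbb{R}$ with density $$\frac{\mathrm dF_{t,0}(x)}{\mathrm dx} \propto \exp\Big(\frac{H^{(4)}(m_*)}{24}x^4 + t\,p\,m_*^{p-1}x\Big);$$ it is well defined and has a finite mean. We write $F_{0,0}(\cdot)$ also for the distribution function of $F_{0,0}$. Then, as $N\to\infty$, $$N^{3/4}(\hat\beta_N-\beta)\xrightarrow{D} G_2,$$ where $G_2$ is the probability law on $\mathbb{R}$ with distribution function $$G_2(t) = F_{0,0}\Big(\operatorname{sgn}(m_*^{p-1})\int_{-\infty}^{\infty}u\,\mathrm dF_{t,0}(u)\Big),\qquad t\in\mathbb{R}.$$ (The sign equals $1$ unless $p$ is even and $m_*<0$. Convergence in distribution is that of $[-\infty,\infty]$-valued random variables.) -/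

import Mathlib

open MeasureTheory ProbabilityTheory Filter Topology

namespace CurieWeiss

noncomputable section

/-- Configurations of `N` spins; `ℤˣ` is the two-point set `{-1, 1}`. -/
abbrev Config (N : ℕ) : Type := Fin N → ℤˣ

/-- The value `±1` of the `i`-th spin, as a real number. -/
def spin {N : ℕ} (x : Config N) (i : Fin N) : ℝ := ((x i : ℤ) : ℝ)

/-- The unnormalised Gibbs weight
`exp (β / N ^ (p - 1) * ∑ x_{i₁} ⋯ x_{i_p} + h * ∑ x_i)`,
the first sum running over all `p`-tuples of indices. -/
def weight (p : ℕ) (β h : ℝ) {N : ℕ} (x : Config N) : ℝ :=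
  Real.exp (β / (N : ℝ) ^ (p - 1) * ∑ i : Fin p → Fin N, ∏ k : Fin p, spin x (i k)
    + h * ∑ i : Fin N, spin x i)

/-- The partition function `Z_N(β, h, p)`. -/
def partitionFn (p : ℕ) (β h : ℝ) (N : ℕ) : ℝ :=
  (1 / 2 ^ N) * ∑ x : Config N, weight p β h x

/-- The probability of the configuration `x` under the `p`-tensor Curie-Weiss model; as a function
of the parameters it is the likelihood of the observation `x`. -/
def prob (p : ℕ) (β h : ℝ) {N : ℕ} (x : Config N) : ℝ :=
  weight p β h x / (2 ^ N * partitionFn p β h N)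

theorem weight_pos (p : ℕ) (β h : ℝ) {N : ℕ} (x : Config N) : 0 < weight p β h x :=
  Real.exp_pos _

theorem two_pow_mul_partitionFn (p : ℕ) (β h : ℝ) (N : ℕ) :
    2 ^ N * partitionFn p β h N = ∑ x : Config N, weight p β h x := by
  unfold partitionFn
  field_simp

theorem sum_weight_pos (p : ℕ) (β h : ℝ) (N : ℕ) : 0 < ∑ x : Config N, weight p β h x :=
  Finset.sum_pos (fun x _ => weight_pos p β h x) Finset.univ_nonempty

theorem prob_nonneg (p : ℕ) (β h : ℝ) {N : ℕ} (x : Config N) : 0 ≤ prob p β h x := by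
  unfold prob
  rw [two_pow_mul_partitionFn]
  exact div_nonneg (weight_pos p β h x).le (sum_weight_pos p β h N).le

theorem sum_prob (p : ℕ) (β h : ℝ) (N : ℕ) : ∑ x : Config N, prob p β h x = 1 := by
  simp only [prob, two_pow_mul_partitionFn, ← Finset.sum_div]
  exact div_self (sum_weight_pos p β h N).ne'

/-- The `p`-tensor Curie-Weiss model on `{-1, 1}^N`. -/
def modelPMF (p : ℕ) (β h : ℝ) (N : ℕ) : PMF (Config N) :=
  PMF.ofFintype (fun x => ENNReal.ofReal (prob p β h x)) (by
    rw [← ENNReal.ofReal_sum_of_nonneg (fun x _ => prob_nonneg p β h x), sum_prob,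
      ENNReal.ofReal_one])

/-- The law `ℙ_{β,h,p}` of the sample, as a measure. -/
def model (p : ℕ) (β h : ℝ) (N : ℕ) : Measure (Config N) := (modelPMF p β h N).toMeasure

instance (p : ℕ) (β h : ℝ) (N : ℕ) : IsProbabilityMeasure (model p β h N) :=
  PMF.toMeasure.isProbabilityMeasure _

/-- `b ∈ [-∞, ∞]` is a maximum likelihood estimate of `β` from the sample `x`, with `h` known:
either `b` is a real number that maximises the likelihood over `ℝ`, or `b = ∞` (`b = -∞`) and the
supremum of the likelihood is its limit at `∞` (at `-∞`). -/
def IsBetaMLE (p : ℕ) (h : ℝ) {N : ℕ} (x : Config N) (b : EReal) : Prop :=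
  (∃ b₀ : ℝ, b = (b₀ : EReal) ∧ ∀ β' : ℝ, prob p β' h x ≤ prob p b₀ h x) ∨
  (b = ⊤ ∧ Tendsto (fun β' : ℝ => prob p β' h x) atTop (𝓝 (⨆ β' : ℝ, prob p β' h x))) ∨
  (b = ⊥ ∧ Tendsto (fun β' : ℝ => prob p β' h x) atBot (𝓝 (⨆ β' : ℝ, prob p β' h x)))

/-- An estimate always exists in `[-∞, ∞]`. -/
theorem exists_isBetaMLE (p : ℕ) (h : ℝ) {N : ℕ} (x : Config N) :
    ∃ b : EReal, IsBetaMLE p h x b := by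
  obtain ⟨T, c, hw⟩ : ∃ T c : Config N → ℝ,
      ∀ (β : ℝ) (y : Config N), weight p β h y = Real.exp (β * T y + c y) := by
    refine ⟨fun y => (∑ i : Fin p → Fin N, ∏ k : Fin p, spin y (i k)) / (N : ℝ) ^ (p - 1),
      fun y => h * ∑ i : Fin N, spin y i, fun β y => ?_⟩
    simp only [weight]
    congr 1
    ring
  have hsum : ∀ β : ℝ, 0 < ∑ y : Config N, Real.exp (β * (T y - T x) + (c y - c x)) := fun β =>
    Finset.sum_pos (fun y _ => Real.exp_pos _) Finset.univ_nonempty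
  have hL : ∀ β : ℝ, prob p β h x =
      (∑ y : Config N, Real.exp (β * (T y - T x) + (c y - c x)))⁻¹ := by
    intro β
    have e : ∑ y : Config N, weight p β h y = weight p β h x *
        ∑ y : Config N, Real.exp (β * (T y - T x) + (c y - c x)) := by
      rw [Finset.mul_sum]
      refine Finset.sum_congr rfl fun y _ => ?_
      rw [hw, hw, ← Real.exp_add]
      congr 1
      ring
    rw [prob, two_pow_mul_partitionFn, e, div_mul_eq_div_div,
      div_self (weight_pos p β h x).ne', one_div]
  have hbdd : BddAbove (Set.range fun β : ℝ => prob p β h x) := by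
    refine ⟨1, ?_⟩
    rintro _ ⟨β, rfl⟩
    rw [← sum_prob p β h N]
    exact Finset.single_le_sum (f := fun y => prob p β h y) (fun y _ => prob_nonneg p β h y)
      (Finset.mem_univ x)
  by_cases h1 : ∀ y, T y ≤ T x
  · refine ⟨⊤, Or.inr (Or.inl ⟨rfl, tendsto_atTop_ciSup ?_ hbdd⟩)⟩
    intro a b hab
    simp only [hL]
    refine inv_anti₀ (hsum b) (Finset.sum_le_sum fun y _ => Real.exp_le_exp.2 ?_)
    nlinarith [h1 y]
  by_cases h2 : ∀ y, T x ≤ T y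
  · refine ⟨⊥, Or.inr (Or.inr ⟨rfl, tendsto_atBot_ciSup ?_ hbdd⟩)⟩
    intro a b hab
    simp only [hL]
    refine inv_anti₀ (hsum a) (Finset.sum_le_sum fun y _ => Real.exp_le_exp.2 ?_)
    nlinarith [h2 y]
  push Not at h1 h2
  obtain ⟨y, hy⟩ := h1
  obtain ⟨z, hz⟩ := h2
  have hle : ∀ (β : ℝ) (w : Config N),
      prob p β h x ≤ Real.exp (-(β * (T w - T x) + (c w - c x))) := by
    intro β w
    rw [hL, Real.exp_neg]
    exact inv_anti₀ (Real.exp_pos _) (Finset.single_le_sum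
      (f := fun y => Real.exp (β * (T y - T x) + (c y - c x)))
      (fun y _ => (Real.exp_pos _).le) (Finset.mem_univ w))
  have hcont : Continuous fun β : ℝ => prob p β h x := by
    simp only [hL]
    exact Continuous.inv₀ (by fun_prop) fun β => (hsum β).ne'
  have h0 : 0 < prob p 0 h x := by rw [hL]; exact inv_pos.2 (hsum 0)
  have htop : Tendsto (fun β : ℝ => prob p β h x) atTop (𝓝 0) := by
    refine squeeze_zero (fun β => prob_nonneg p β h x) (fun β => hle β y) ?_
    refine Real.tendsto_exp_neg_atTop_nhds_zero.comp ?_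
    exact tendsto_atTop_add_const_right _ _ (tendsto_id.atTop_mul_const (sub_pos.2 hy))
  have hbot : Tendsto (fun β : ℝ => prob p β h x) atBot (𝓝 0) := by
    refine squeeze_zero (fun β => prob_nonneg p β h x) (fun β => hle β z) ?_
    refine Real.tendsto_exp_neg_atTop_nhds_zero.comp ?_
    exact tendsto_atTop_add_const_right _ _ (tendsto_id.atBot_mul_const_of_neg (sub_neg.2 hz))
  obtain ⟨b, hb⟩ := hcont.exists_forall_ge' 0 (by
    rw [cocompact_eq_atBot_atTop, eventually_sup]
    exact ⟨(hbot.eventually_lt_const h0).mono fun _ h => h.le,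
      (htop.eventually_lt_const h0).mono fun _ h => h.le⟩)
  exact ⟨b, Or.inl ⟨b, rfl, hb⟩⟩

/-- The binary entropy function `I` (recall `Real.log 0 = 0`). -/
def entropy (x : ℝ) : ℝ := (1 / 2) * ((1 + x) * Real.log (1 + x) + (1 - x) * Real.log (1 - x))

/-- The function `H_{β,h,p}`; only its values on `[-1, 1]` matter. -/
def H (p : ℕ) (β h : ℝ) (x : ℝ) : ℝ := β * x ^ p + h * x - entropy x

/-- `m ∈ (-1, 1)` is the unique global maximizer of `H_{β,h,p}` on `[-1, 1]`. -/
def IsUniqueMaximizer (p : ℕ) (β h m : ℝ) : Prop :=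
  m ∈ Set.Ioo (-1 : ℝ) 1 ∧ ∀ x ∈ Set.Icc (-1 : ℝ) 1, x ≠ m → H p β h x < H p β h m

/-- `(β, h) ∈ [0, ∞) × ℝ` is `p`-special. -/
def IsSpecial (p : ℕ) (β h : ℝ) : Prop :=
  0 ≤ β ∧ ∃ m : ℝ, IsUniqueMaximizer p β h m ∧ iteratedDeriv 2 (H p β h) m = 0

/-- The law `F_{b,c}` on `ℝ` whose density is proportional to
`exp (H⁗(m) / 24 * x ^ 4 + (b * p * m ^ (p - 1) + c) * x)`. -/
def quarticLaw (p : ℕ) (β h m : ℝ) (b c : ℝ) : Measure ℝ :=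
  volume.tilted (fun x : ℝ =>
    iteratedDeriv 4 (H p β h) m / 24 * x ^ 4 + (b * p * m ^ (p - 1) + c) * x)

end

end CurieWeiss

/-! Write `x̄` for the mean spin. For fixed `h` the model is an exponential family in `β` with
sufficient statistic `N x̄ ^ p`, so the reciprocal likelihood is a sum of exponentials, strictly
convex once the statistic is not constant. Hence the estimate is at most `b` exactly when the
observed `x̄ ^ p` is at most its expectation at `b` (`mle_le_iff`, `IsBetaMLE.le_iff`). For `b = β +
t N ^ (-3/4)` this turns the distribution function of the rescaled estimate at `t` into the
probability, under `β`, that `x̄ ^ p` stays below an expectation taken under the shifted parameter.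

Both ingredients come from one local limit theorem for `u = N ^ (1/4) (x̄ - m)` under `β + t N ^
(-3/4)`. At a special point the first three derivatives of `H` vanish at `m` and the fourth is
negative, so `N (H (x̄) - H (m))` tends to `H⁗(m) u ^ 4 / 24`. The shift of `β` contributes `t N ^
(1/4) (x̄ ^ p - m ^ p)`, which tends to `t p m ^ (p - 1) u`, and the binomial prefactor tends to a
constant by Stirling's formula. The sum over the lattice of values of `x̄` is an integral of a step
function, and dominated convergence applies thanks to a global quartic bound on `H`
(`tendsto_localDensity`, `exists_integrable_bound`, `tendsto_expectation`).

After centring and scaling, the event becomes `m ^ (p - 1) U ≤ m ^ (p - 1) M(t)`, with `U` of law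
`F_{0,0}` and `M(t)` the mean of `F_{t,0}` (`tendsto_prob_pow_le`). If `m ^ (p - 1) < 0` the
inequality reverses, and the symmetry of `F_{0,0}` produces the sign in the limit. The limit is a
genuine distribution function because `M` is the derivative of a cumulant generating function, up to
a linear change of variable: it is continuous, monotone up to that sign, and unbounded in both
directions. -/

namespace CurieWeiss

/-! ### Derivatives of `H` at a special point -/

section Calculus

theorem continuous_entropy : Continuous entropy := by
  have h1 : Continuous fun x : ℝ => (1 + x) * Real.log (1 + x) :=
    Real.continuous_mul_log.comp (by fun_prop : Continuous fun x : ℝ => 1 + x)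
  have h2 : Continuous fun x : ℝ => (1 - x) * Real.log (1 - x) :=
    Real.continuous_mul_log.comp (by fun_prop : Continuous fun x : ℝ => 1 - x)
  exact continuous_const.mul (h1.add h2)

theorem continuous_H (p : ℕ) (β h : ℝ) : Continuous (H p β h) := by
  have := continuous_entropy
  unfold H
  fun_prop

theorem contDiffOn_H (p : ℕ) (β h : ℝ) {n : WithTop ℕ∞} :
    ContDiffOn ℝ n (H p β h) (Set.Ioo (-1) 1) := by
  have h1 : ContDiffOn ℝ n (fun x : ℝ => Real.log (1 + x)) (Set.Ioo (-1) 1) :=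
    (contDiff_const.add contDiff_id).contDiffOn.log fun x hx => by
      simp only [id]; linarith [hx.1]
  have h2 : ContDiffOn ℝ n (fun x : ℝ => Real.log (1 - x)) (Set.Ioo (-1) 1) :=
    (contDiff_const.sub contDiff_id).contDiffOn.log fun x hx => by
      simp only [id]; linarith [hx.2]
  unfold H entropy
  fun_prop

/-- The closed formulas for the derivatives of `H` are proved only inside `(-1, 1)`; openness makes
a formula valid on a neighbourhood of each point, so it may be differentiated again. -/
theorem iteratedDeriv_succ_eqOn {f g g' : ℝ → ℝ} {U : Set ℝ} (hU : IsOpen U) {n : ℕ}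
    (hf : ∀ x ∈ U, iteratedDeriv n f x = g x) (hg : ∀ x ∈ U, HasDerivAt g (g' x) x) :
    ∀ x ∈ U, iteratedDeriv (n + 1) f x = g' x := by
  intro x hx
  rw [iteratedDeriv_succ, ← (hg x hx).deriv]
  exact Filter.EventuallyEq.deriv_eq (Filter.eventually_of_mem (hU.mem_nhds hx) hf)

theorem iteratedDeriv_one_H (p : ℕ) (β h : ℝ) : ∀ x ∈ Set.Ioo (-1 : ℝ) 1,
    iteratedDeriv 1 (H p β h) x =
      β * (p * x ^ (p - 1)) + h - 1 / 2 * (Real.log (1 + x) - Real.log (1 - x)) := by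
  refine iteratedDeriv_succ_eqOn isOpen_Ioo (n := 0) (fun x _ => by rw [iteratedDeriv_zero]) ?_
  intro x hx
  have hp : (0 : ℝ) < 1 + x := by linarith [hx.1]
  have hm : (0 : ℝ) < 1 - x := by linarith [hx.2]
  have h1 := ((hasDerivAt_id x).const_add 1).mul (((hasDerivAt_id x).const_add 1).log hp.ne')
  have h2 := ((hasDerivAt_id x).const_sub 1).mul (((hasDerivAt_id x).const_sub 1).log hm.ne')
  have h3 := (((hasDerivAt_pow p x).const_mul β).add ((hasDerivAt_id x).const_mul h)).sub
    ((h1.add h2).const_mul (1 / 2))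
  refine h3.congr_deriv ?_
  simp only [id]
  field_simp
  ring

theorem iteratedDeriv_two_H (p : ℕ) (β h : ℝ) : ∀ x ∈ Set.Ioo (-1 : ℝ) 1,
    iteratedDeriv 2 (H p β h) x =
      β * (p * ((p - 1 : ℕ) * x ^ (p - 1 - 1))) - 1 / 2 * ((1 + x)⁻¹ + (1 - x)⁻¹) := by
  refine iteratedDeriv_succ_eqOn isOpen_Ioo (iteratedDeriv_one_H p β h) ?_
  intro x hx
  have hp : (0 : ℝ) < 1 + x := by linarith [hx.1]
  have hm : (0 : ℝ) < 1 - x := by linarith [hx.2]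
  have h1 := ((hasDerivAt_id x).const_add 1).log hp.ne'
  have h2 := ((hasDerivAt_id x).const_sub 1).log hm.ne'
  have h3 := ((((hasDerivAt_pow (p - 1) x).const_mul (p : ℝ)).const_mul β).add_const h).sub
    ((h1.sub h2).const_mul (1 / 2))
  refine h3.congr_deriv ?_
  simp only [id]
  field_simp
  ring

theorem iteratedDeriv_three_H (p : ℕ) (β h : ℝ) : ∀ x ∈ Set.Ioo (-1 : ℝ) 1,
    iteratedDeriv 3 (H p β h) x =
      β * (p * ((p - 1 : ℕ) * ((p - 1 - 1 : ℕ) * x ^ (p - 1 - 1 - 1))))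
        - 1 / 2 * (-((1 + x) ^ 2)⁻¹ + ((1 - x) ^ 2)⁻¹) := by
  refine iteratedDeriv_succ_eqOn isOpen_Ioo (iteratedDeriv_two_H p β h) ?_
  intro x hx
  have hp : (0 : ℝ) < 1 + x := by linarith [hx.1]
  have hm : (0 : ℝ) < 1 - x := by linarith [hx.2]
  have h1 := ((hasDerivAt_id x).const_add 1).inv hp.ne'
  have h2 := ((hasDerivAt_id x).const_sub 1).inv hm.ne'
  have h3 := ((((hasDerivAt_pow (p - 1 - 1) x).const_mul ((p - 1 : ℕ) : ℝ)).const_mul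
    (p : ℝ)).const_mul β).sub ((h1.add h2).const_mul (1 / 2))
  refine h3.congr_deriv ?_
  simp only [id]
  field_simp

theorem iteratedDeriv_four_H (p : ℕ) (β h : ℝ) : ∀ x ∈ Set.Ioo (-1 : ℝ) 1,
    iteratedDeriv 4 (H p β h) x =
      β * (p * ((p - 1 : ℕ) * ((p - 1 - 1 : ℕ) * ((p - 1 - 1 - 1 : ℕ) * x ^ (p - 1 - 1 - 1 - 1)))))
        - (((1 + x) ^ 3)⁻¹ + ((1 - x) ^ 3)⁻¹) := by
  refine iteratedDeriv_succ_eqOn isOpen_Ioo (iteratedDeriv_three_H p β h) ?_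
  intro x hx
  have hp : (0 : ℝ) < 1 + x := by linarith [hx.1]
  have hm : (0 : ℝ) < 1 - x := by linarith [hx.2]
  have h1 := (((hasDerivAt_id x).const_add 1).pow 2).inv (pow_pos hp 2).ne'
  have h2 := (((hasDerivAt_id x).const_sub 1).pow 2).inv (pow_pos hm 2).ne'
  have h3 := (((((hasDerivAt_pow (p - 1 - 1 - 1) x).const_mul ((p - 1 - 1 : ℕ) : ℝ)).const_mul
    ((p - 1 : ℕ) : ℝ)).const_mul (p : ℝ)).const_mul β).sub ((h1.neg.add h2).const_mul (1 / 2))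
  refine h3.congr_deriv ?_
  simp only [id, Pi.pow_apply]
  field_simp
  ring

variable {p : ℕ} {β h m : ℝ}

theorem IsUniqueMaximizer.le (hm : IsUniqueMaximizer p β h m) {x : ℝ}
    (hx : x ∈ Set.Icc (-1 : ℝ) 1) : H p β h x ≤ H p β h m := by
  rcases eq_or_ne x m with rfl | hne
  · exact le_rfl
  · exact (hm.2 x hx hne).le

theorem IsUniqueMaximizer.eventually_le (hm : IsUniqueMaximizer p β h m) :
    ∀ᶠ x in 𝓝 m, H p β h x ≤ H p β h m := by
  filter_upwards [Ioo_mem_nhds hm.1.1 hm.1.2] with x hx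
  exact hm.le ⟨hx.1.le, hx.2.le⟩

theorem IsUniqueMaximizer.iteratedDeriv_one (hm : IsUniqueMaximizer p β h m) :
    iteratedDeriv 1 (H p β h) m = 0 := by
  rw [_root_.iteratedDeriv_one]
  exact IsLocalMax.deriv_eq_zero hm.eventually_le

theorem IsSpecial.iteratedDeriv_two (hs : IsSpecial p β h) (hm : IsUniqueMaximizer p β h m) :
    iteratedDeriv 2 (H p β h) m = 0 := by
  obtain ⟨-, m', hm', h2⟩ := hs
  have : m' = m := by
    by_contra hne
    have h1 := hm.2 m' ⟨hm'.1.1.le, hm'.1.2.le⟩ hne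
    have h2 := hm'.2 m ⟨hm.1.1.le, hm.1.2.le⟩ (Ne.symm hne)
    linarith
  rwa [← this]

theorem isLittleO_H_sub_pow_three (hm : m ∈ Set.Ioo (-1 : ℝ) 1)
    (h1 : iteratedDeriv 1 (H p β h) m = 0) (h2 : iteratedDeriv 2 (H p β h) m = 0) :
    (fun x => H p β h x - H p β h m - iteratedDeriv 3 (H p β h) m / 6 * (x - m) ^ 3)
      =o[𝓝 m] fun x => (x - m) ^ 3 := by
  have := taylor_isLittleO (n := 3) (convex_Ioo (-1 : ℝ) 1) hm (contDiffOn_H p β h)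
  rw [isOpen_Ioo.nhdsWithin_eq hm] at this
  refine this.congr_left fun x => ?_
  simp only [taylorWithinEval_succ, taylor_within_zero_eval,
    iteratedDerivWithin_of_isOpen isOpen_Ioo hm, zero_add, h1, h2]
  norm_num
  ring

theorem isLittleO_H_sub_pow_four (hm : m ∈ Set.Ioo (-1 : ℝ) 1)
    (h1 : iteratedDeriv 1 (H p β h) m = 0) (h2 : iteratedDeriv 2 (H p β h) m = 0)
    (h3 : iteratedDeriv 3 (H p β h) m = 0) :
    (fun x => H p β h x - H p β h m - iteratedDeriv 4 (H p β h) m / 24 * (x - m) ^ 4)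
      =o[𝓝 m] fun x => (x - m) ^ 4 := by
  have := taylor_isLittleO (n := 4) (convex_Ioo (-1 : ℝ) 1) hm (contDiffOn_H p β h)
  rw [isOpen_Ioo.nhdsWithin_eq hm] at this
  refine this.congr_left fun x => ?_
  simp only [taylorWithinEval_succ, taylor_within_zero_eval,
    iteratedDerivWithin_of_isOpen isOpen_Ioo hm, zero_add, h1, h2, h3, Nat.factorial]
  norm_num
  ring

/-- A nonzero cubic leading term changes sign at `m`, which is impossible at a maximum. The error is
taken at half the cubic coefficient, so the sign survives on the appropriate side. -/
theorem IsSpecial.iteratedDeriv_three (hs : IsSpecial p β h) (hm : IsUniqueMaximizer p β h m) :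
    iteratedDeriv 3 (H p β h) m = 0 := by
  have ho := isLittleO_H_sub_pow_three hm.1 hm.iteratedDeriv_one (hs.iteratedDeriv_two hm)
  have hle := hm.eventually_le
  set D := iteratedDeriv 3 (H p β h) m
  by_contra hD
  have hb := ho.bound (c := |D| / 12) (by positivity)
  have key := hb.and hle
  rcases lt_or_gt_of_ne hD with hD | hD
  · obtain ⟨x, ⟨hx1, hx2⟩, hx3⟩ := ((key.filter_mono nhdsWithin_le_nhds).and
      (self_mem_nhdsWithin : Set.Iio m ∈ 𝓝[<] m)).exists
    have hx3 : x < m := hx3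
    have hy : (x - m) ^ 3 < 0 := Odd.pow_neg (by decide) (by linarith)
    rw [Real.norm_eq_abs, Real.norm_eq_abs, abs_of_neg hy, abs_of_neg hD, abs_le] at hx1
    nlinarith [mul_pos_of_neg_of_neg hD hy]
  · obtain ⟨x, ⟨hx1, hx2⟩, hx3⟩ := ((key.filter_mono nhdsWithin_le_nhds).and
      (self_mem_nhdsWithin : Set.Ioi m ∈ 𝓝[>] m)).exists
    have hx3 : m < x := hx3
    have hy : 0 < (x - m) ^ 3 := pow_pos (by linarith) 3
    rw [Real.norm_eq_abs, Real.norm_eq_abs, abs_of_pos hy, abs_of_pos hD, abs_le] at hx1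
    nlinarith [mul_pos hD hy]

/-- At `0` the power term drops out of the second derivative because `p ≥ 3`, leaving `-1`. -/
theorem IsSpecial.ne_zero (hp : 3 ≤ p) (hs : IsSpecial p β h) (hm : IsUniqueMaximizer p β h m) :
    m ≠ 0 := by
  rintro rfl
  have h2 := hs.iteratedDeriv_two hm
  rw [iteratedDeriv_two_H p β h 0 hm.1, zero_pow (by omega)] at h2
  norm_num at h2

/-- With `A = β p (p - 1) m ^ (p - 2)`, the vanishing of the second and third derivatives gives `A
(1 - m²) = 1` and `A (p - 2) (1 - m²)² = 2 m²`, hence `p (1 - m²) = 2`. Substituting, `m² (1 - m²)³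
H⁗(m) = -4 m²`. -/
theorem IsSpecial.iteratedDeriv_four_neg (hp : 3 ≤ p) (hs : IsSpecial p β h)
    (hm : IsUniqueMaximizer p β h m) : iteratedDeriv 4 (H p β h) m < 0 := by
  have h0 := hs.ne_zero hp hm
  have h2 := hs.iteratedDeriv_two hm
  have h3 := hs.iteratedDeriv_three hm
  rw [iteratedDeriv_two_H p β h m hm.1] at h2
  rw [iteratedDeriv_three_H p β h m hm.1] at h3
  rw [iteratedDeriv_four_H p β h m hm.1]
  obtain ⟨q, rfl⟩ := Nat.exists_eq_add_of_le' hp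
  have e1 : q + 3 - 1 = q + 2 := rfl
  have e2 : q + 2 - 1 = q + 1 := rfl
  have e3 : q + 1 - 1 = q := rfl
  simp only [e1, e2, e3] at *
  have ha : (0 : ℝ) < 1 + m := by linarith [hm.1.1]
  have hb : (0 : ℝ) < 1 - m := by linarith [hm.1.2]
  have hw : 0 < 1 - m ^ 2 := by nlinarith
  have hq : (0 : ℝ) ≤ q := Nat.cast_nonneg q
  push_cast at *
  set A : ℝ := β * ((q + 3) * ((q + 2) * m ^ (q + 1))) with hA
  have k2 : A * (1 - m ^ 2) = 1 := by
    field_simp at h2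
    linarith
  have k3 : A * (q + 1) * (1 - m ^ 2) ^ 2 = 2 * m ^ 2 := by
    have : A * (q + 1) = m * (1 / 2 * (-((1 + m) ^ 2)⁻¹ + ((1 - m) ^ 2)⁻¹)) := by
      rw [hA, pow_succ]; linear_combination m * h3
    rw [this]
    field_simp
    ring
  have k4 : (q + 3) * (1 - m ^ 2) = 2 := by linear_combination k3 - (q + 1) * (1 - m ^ 2) * k2
  -- The factor `m ^ 2` restores the power in `A`; `q = 0` is separate because `q - 1` is then
  -- truncated.
  have k5 : m ^ 2 * (β * ((q + 3) * ((q + 2) * ((q + 1) * (q * m ^ (q - 1)))))) =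
      A * (q + 1) * q := by
    rcases Nat.eq_zero_or_pos q with rfl | hq
    · simp
    · obtain ⟨r, rfl⟩ := Nat.exists_eq_add_of_lt hq
      simp only [hA, zero_add, Nat.add_sub_cancel]
      ring
  have k6 : ((1 + m) ^ 3)⁻¹ + ((1 - m) ^ 3)⁻¹ = (2 + 6 * m ^ 2) / (1 - m ^ 2) ^ 3 := by
    have : (1 - m ^ 2) = (1 + m) * (1 - m) := by ring
    rw [this]
    field_simp
    ring
  have hm2 : 0 < m ^ 2 := by positivity
  refine neg_of_mul_neg_right (a := m ^ 2) ?_ hm2.le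
  rw [mul_sub, k5, k6]
  refine neg_of_mul_neg_right (a := (1 - m ^ 2) ^ 3) ?_ (by positivity)
  have : (1 - m ^ 2) ^ 3 * (A * (q + 1) * q - m ^ 2 * ((2 + 6 * m ^ 2) / (1 - m ^ 2) ^ 3)) =
      (1 - m ^ 2) * (2 * m ^ 2 * q) - m ^ 2 * (2 + 6 * m ^ 2) := by
    field_simp
    linear_combination (1 - m ^ 2) * q * k3
  rw [this]
  have : (1 - m ^ 2) * (2 * m ^ 2 * q) - m ^ 2 * (2 + 6 * m ^ 2) = - 4 * m ^ 2 := by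
    linear_combination 2 * m ^ 2 * k4
  rw [this]
  linarith

theorem IsSpecial.isLittleO (hs : IsSpecial p β h) (hm : IsUniqueMaximizer p β h m) :
    (fun x => H p β h x - H p β h m - iteratedDeriv 4 (H p β h) m / 24 * (x - m) ^ 4)
      =o[𝓝 m] fun x => (x - m) ^ 4 :=
  isLittleO_H_sub_pow_four hm.1 hm.iteratedDeriv_one (hs.iteratedDeriv_two hm)
    (hs.iteratedDeriv_three hm)

theorem IsSpecial.exists_quartic_bound (hp : 3 ≤ p) (hs : IsSpecial p β h)
    (hm : IsUniqueMaximizer p β h m) :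
    ∃ c > 0, ∀ x ∈ Set.Icc (-1 : ℝ) 1, H p β h x - H p β h m ≤ -c * (x - m) ^ 4 := by
  have hD := hs.iteratedDeriv_four_neg hp hm
  have hb := (hs.isLittleO hm).bound (c := -iteratedDeriv 4 (H p β h) m / 48) (by linarith)
  set D := iteratedDeriv 4 (H p β h) m
  obtain ⟨δ, hδ, hball⟩ := Metric.eventually_nhds_iff.1 hb
  have hK : IsCompact (Set.Icc (-1 : ℝ) 1 ∩ {x | δ ≤ dist x m}) :=
    isCompact_Icc.inter_right (isClosed_le continuous_const (by fun_prop))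
  obtain ⟨g, hg, hgap⟩ : ∃ g > 0, ∀ x ∈ Set.Icc (-1 : ℝ) 1 ∩ {x | δ ≤ dist x m},
      H p β h x - H p β h m ≤ -g := by
    rcases (Set.Icc (-1 : ℝ) 1 ∩ {x | δ ≤ dist x m}).eq_empty_or_nonempty with he | hne
    · exact ⟨1, one_pos, by simp [he]⟩
    · obtain ⟨y, hy, hmax⟩ := hK.exists_isMaxOn hne (continuous_H p β h).continuousOn
      have hym : y ≠ m := by
        rintro rfl
        have : δ ≤ dist y y := hy.2
        simp at this
        linarith
      refine ⟨H p β h m - H p β h y, sub_pos.2 (hm.2 y hy.1 hym), fun x hx => ?_⟩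
      have : H p β h x ≤ H p β h y := hmax hx
      linarith
  -- Near `m` half of the Taylor coefficient `-D / 24` survives; away from `m` the gap `g` is
  -- compared with `(x - m) ^ 4 ≤ 16`.
  refine ⟨min (-D / 48) (g / 16), lt_min (by linarith) (by linarith), fun x hx => ?_⟩
  have h4 : 0 ≤ (x - m) ^ 4 := by positivity
  by_cases hxd : dist x m < δ
  · have := hball hxd
    rw [Real.norm_eq_abs, Real.norm_eq_abs, abs_of_nonneg h4, abs_le] at this
    nlinarith [min_le_left (-D / 48) (g / 16)]
  · have h16 : (x - m) ^ 4 ≤ 16 := by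
      have h2 : |x - m| ≤ 2 := by
        rw [abs_le]; constructor <;> linarith [hx.1, hx.2, hm.1.1, hm.1.2]
      calc (x - m) ^ 4 = |x - m| ^ 4 := by rw [← abs_pow, abs_of_nonneg h4]
        _ ≤ 2 ^ 4 := pow_le_pow_left₀ (abs_nonneg _) h2 4
        _ = 16 := by norm_num
    have := hgap x ⟨hx, not_lt.1 hxd⟩
    nlinarith [min_le_right (-D / 48) (g / 16), lt_min (by linarith : 0 < -D / 48) (by linarith : 0 < g / 16)]

end Calculus

/-! ### The quartic laws and their means -/

section QuarticLaw

/-- Completing squares twice gives domination by a Gaussian, from which all integrability below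
follows. -/
theorem neg_quartic_add_le {a : ℝ} (ha : 0 < a) (b x : ℝ) :
    -a * x ^ 4 + b * |x| ≤ 1 / a + b ^ 2 / 4 + -1 * x ^ 2 := by
  have h1 : b * |x| ≤ x ^ 2 + b ^ 2 / 4 := by nlinarith [sq_nonneg (|x| - b / 2), sq_abs x]
  have h2 : -a * x ^ 4 + 2 * x ^ 2 ≤ 1 / a := by
    rw [le_div_iff₀ ha]
    nlinarith [sq_nonneg (a * x ^ 2 - 1)]
  linarith

theorem integrable_exp_quartic_abs {a : ℝ} (ha : 0 < a) (b : ℝ) :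
    Integrable fun x : ℝ => Real.exp (-a * x ^ 4 + b * |x|) := by
  refine ((integrable_exp_neg_mul_sq one_pos).const_mul (Real.exp (1 / a + b ^ 2 / 4))).mono'
    (by fun_prop) (Eventually.of_forall fun x => ?_)
  rw [Real.norm_eq_abs, Real.abs_exp, ← Real.exp_add]
  exact Real.exp_le_exp.2 (neg_quartic_add_le ha b x)

theorem integrable_one_add_abs_mul_exp_quartic {a : ℝ} (ha : 0 < a) (b : ℝ) :
    Integrable fun x : ℝ => (1 + |x|) * Real.exp (-a * x ^ 4 + b * |x|) := by
  refine (integrable_exp_quartic_abs ha (b + 1)).mono'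
    (by fun_prop) (Eventually.of_forall fun x => ?_)
  rw [Real.norm_eq_abs, abs_of_nonneg (by positivity)]
  have : Real.exp (-a * x ^ 4 + (b + 1) * |x|) =
      Real.exp |x| * Real.exp (-a * x ^ 4 + b * |x|) := by
    rw [← Real.exp_add]; ring_nf
  rw [this]
  gcongr
  linarith [Real.add_one_le_exp |x|]

theorem integrable_exp_quartic {a : ℝ} (ha : 0 < a) (s : ℝ) :
    Integrable fun x : ℝ => Real.exp (-a * x ^ 4 + s * x) := by
  refine (integrable_exp_quartic_abs ha |s|).mono'
    (by fun_prop) (Eventually.of_forall fun x => ?_)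
  rw [Real.norm_eq_abs, Real.abs_exp, ← abs_mul]
  exact Real.exp_le_exp.2 (by linarith [le_abs_self (s * x)])

theorem integrable_mul_exp_quartic {a : ℝ} (ha : 0 < a) (s : ℝ) :
    Integrable fun x : ℝ => Real.exp (-a * x ^ 4 + s * x) * x := by
  refine (integrable_one_add_abs_mul_exp_quartic ha |s|).mono'
    (by fun_prop) (Eventually.of_forall fun x => ?_)
  rw [norm_mul, Real.norm_eq_abs, Real.norm_eq_abs, Real.abs_exp, ← abs_mul, mul_comm]
  gcongr
  · linarith
  · exact le_abs_self _

/-- The law on `ℝ` with density proportional to `exp (-a x⁴ + s x)`. -/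
noncomputable def quarticTilt (a s : ℝ) : Measure ℝ :=
  volume.tilted fun x : ℝ => -a * x ^ 4 + s * x

theorem isProbabilityMeasure_quarticTilt {a : ℝ} (ha : 0 < a) (s : ℝ) :
    IsProbabilityMeasure (quarticTilt a s) :=
  isProbabilityMeasure_tilted (integrable_exp_quartic ha s)

theorem integrable_id_quarticTilt {a : ℝ} (ha : 0 < a) (s : ℝ) :
    Integrable (fun u : ℝ => u) (quarticTilt a s) := by
  rw [quarticTilt, integrable_tilted_iff (integrable_exp_quartic ha s)]
  exact integrable_mul_exp_quartic ha s

theorem tilted_quarticTilt_zero {a : ℝ} (ha : 0 < a) (s : ℝ) :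
    (quarticTilt a 0).tilted (s * ·) = quarticTilt a s := by
  rw [quarticTilt, tilted_tilted (integrable_exp_quartic ha 0), quarticTilt]
  congr 1
  ext x
  simp

theorem integrableExpSet_quarticTilt {a : ℝ} (ha : 0 < a) :
    integrableExpSet (fun u : ℝ => u) (quarticTilt a 0) = Set.univ := by
  refine Set.eq_univ_of_forall fun s => ?_
  change Integrable _ _
  rw [quarticTilt, integrable_tilted_iff (integrable_exp_quartic ha 0)]
  refine (integrable_exp_quartic ha s).congr (Eventually.of_forall fun x => ?_)
  simp [← Real.exp_add]

/-! ### Means of exponential tilts as derivatives of the cumulant generating function -/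

section TiltedMean

variable {μ : Measure ℝ}

theorem integral_tilted_eq_deriv_cgf (hμ : integrableExpSet (fun u : ℝ => u) μ = Set.univ)
    (s : ℝ) : ∫ u, u ∂(μ.tilted (s * ·)) = deriv (cgf (fun u : ℝ => u) μ) s :=
  integral_tilted_mul_self (X := fun u : ℝ => u) (by rw [hμ, interior_univ]; trivial)

theorem contDiff_cgf (hμ : integrableExpSet (fun u : ℝ => u) μ = Set.univ) :
    ContDiff ℝ 2 (cgf (fun u : ℝ => u) μ) := by
  have h : AnalyticOnNhd ℝ (cgf (fun u : ℝ => u) μ) Set.univ := by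
    simpa [hμ] using analyticOnNhd_cgf (X := fun u : ℝ => u) (μ := μ)
  exact h.contDiff

theorem continuous_integral_tilted (hμ : integrableExpSet (fun u : ℝ => u) μ = Set.univ) :
    Continuous fun s : ℝ => ∫ u, u ∂(μ.tilted (s * ·)) := by
  simp_rw [integral_tilted_eq_deriv_cgf hμ]
  exact (contDiff_cgf hμ).continuous_deriv (by norm_num)

theorem monotone_integral_tilted (hμ : integrableExpSet (fun u : ℝ => u) μ = Set.univ) :
    Monotone fun s : ℝ => ∫ u, u ∂(μ.tilted (s * ·)) := by
  simp_rw [integral_tilted_eq_deriv_cgf hμ]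
  refine monotone_of_deriv_nonneg ?_ fun s => ?_
  · exact ((contDiff_succ_iff_deriv (n := 1)).1 (contDiff_cgf hμ)).2.2.differentiable (by norm_num)
  · have : deriv (deriv (cgf (fun u : ℝ => u) μ)) s =
        iteratedDeriv 2 (cgf (fun u : ℝ => u) μ) s := by
      rw [iteratedDeriv_succ, iteratedDeriv_one]
    rw [this, ← variance_tilted_mul (by rw [hμ, interior_univ]; trivial)]
    exact variance_nonneg _ _

/-- Chernoff's inequality at level `B + 1` bounds the cumulant generating function below by `s (B +
1) + log μ [B + 1, ∞)`, hence by `s B` for large `s`. By the mean value theorem it is at most `s`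
times the tilted mean, since its derivative is nondecreasing. -/
theorem tendsto_integral_tilted_atTop [IsProbabilityMeasure μ]
    (hμ : integrableExpSet (fun u : ℝ => u) μ = Set.univ)
    (hpos : ∀ L, 0 < μ.real (Set.Ici L)) :
    Tendsto (fun s : ℝ => ∫ u, u ∂(μ.tilted (s * ·))) atTop atTop := by
  have hmono := monotone_integral_tilted hμ
  refine tendsto_atTop_atTop_of_monotone hmono fun B => ?_
  obtain ⟨s, hs, hsL⟩ : ∃ s > 0, -Real.log (μ.real (Set.Ici (B + 1))) ≤ s :=
    ⟨max 1 (-Real.log (μ.real (Set.Ici (B + 1)))), lt_max_of_lt_left one_pos, le_max_right _ _⟩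
  refine ⟨s, ?_⟩
  have hint : Integrable (fun u : ℝ => Real.exp (s * u)) μ := by
    have : s ∈ integrableExpSet (fun u : ℝ => u) μ := by rw [hμ]; trivial
    exact this
  have hc := measure_ge_le_exp_cgf (X := fun u : ℝ => u) (B + 1) hs.le hint
  have hlog := Real.log_le_log (hpos (B + 1)) hc
  rw [Real.log_exp] at hlog
  obtain ⟨ξ, hξ, hmv⟩ := exists_deriv_eq_slope (cgf (fun u : ℝ => u) μ) hs
    (contDiff_cgf hμ).continuous.continuousOn
    ((contDiff_cgf hμ).differentiable (by norm_num)).differentiableOn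
  have h1 : deriv (cgf (fun u : ℝ => u) μ) ξ ≤ ∫ u, u ∂(μ.tilted (s * ·)) := by
    rw [← integral_tilted_eq_deriv_cgf hμ]
    exact hmono hξ.2.le
  have h2 : cgf (fun u : ℝ => u) μ s = deriv (cgf (fun u : ℝ => u) μ) ξ * s := by
    rw [hmv, cgf_zero, sub_zero, sub_zero, div_mul_cancel₀ _ hs.ne']
  nlinarith

end TiltedMean

/-- The mean of `quarticTilt a s`. -/
noncomputable def quarticMean (a s : ℝ) : ℝ := ∫ u, u ∂(quarticTilt a s)

theorem quarticMean_eq {a : ℝ} (ha : 0 < a) :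
    quarticMean a = fun s => ∫ u, u ∂((quarticTilt a 0).tilted (s * ·)) := by
  ext s
  rw [quarticMean, tilted_quarticTilt_zero ha]

theorem continuous_quarticMean {a : ℝ} (ha : 0 < a) : Continuous (quarticMean a) := by
  rw [quarticMean_eq ha]
  exact continuous_integral_tilted (integrableExpSet_quarticTilt ha)

theorem monotone_quarticMean {a : ℝ} (ha : 0 < a) : Monotone (quarticMean a) := by
  rw [quarticMean_eq ha]
  exact monotone_integral_tilted (integrableExpSet_quarticTilt ha)

theorem absolutelyContinuous_quarticTilt {a : ℝ} (ha : 0 < a) (s : ℝ) :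
    volume ≪ quarticTilt a s :=
  absolutelyContinuous_tilted (integrable_exp_quartic ha s)

theorem tendsto_quarticMean_atTop {a : ℝ} (ha : 0 < a) :
    Tendsto (quarticMean a) atTop atTop := by
  have := isProbabilityMeasure_quarticTilt ha 0
  rw [quarticMean_eq ha]
  refine tendsto_integral_tilted_atTop (integrableExpSet_quarticTilt ha) fun L => ?_
  rw [measureReal_def]
  refine ENNReal.toReal_pos (fun h0 => ?_) (measure_ne_top _ _)
  have := absolutelyContinuous_quarticTilt ha 0 h0
  simp at this

/-- Reflection serves twice: it makes the mean odd in `s`, which gives its limit at `-∞`, and it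
makes the untilted law symmetric, which handles the case `m ^ (p - 1) < 0`. -/
theorem quarticTilt_map_neg {a : ℝ} (s : ℝ) :
    (quarticTilt a s).map Neg.neg = quarticTilt a (-s) := by
  have he : MeasurableEmbedding (Neg.neg : ℝ → ℝ) := (MeasurableEquiv.neg ℝ).measurableEmbedding
  have hZ : ∫ x : ℝ, Real.exp (-a * x ^ 4 + -s * x) = ∫ x : ℝ, Real.exp (-a * x ^ 4 + s * x) := by
    rw [← integral_neg_eq_self]
    congr 1
    ext x
    congr 1
    ring
  ext A hA
  rw [Measure.map_apply measurable_neg hA, quarticTilt, tilted_apply' _ _ (measurable_neg hA),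
    quarticTilt, tilted_apply' _ _ hA, hZ]
  generalize ∫ x : ℝ, Real.exp (-a * x ^ 4 + s * x) = Z
  have : (volume : Measure ℝ) = (volume : Measure ℝ).map Neg.neg := (Measure.map_neg_eq_self _).symm
  conv_rhs => rw [this, he.restrict_map, he.lintegral_map]
  refine lintegral_congr fun x => ?_
  have hx : -a * x ^ 4 + s * x = -a * (-x) ^ 4 + -s * -x := by ring
  rw [hx]

theorem quarticMean_neg {a : ℝ} (s : ℝ) : quarticMean a (-s) = -quarticMean a s := by
  have he : MeasurableEmbedding (Neg.neg : ℝ → ℝ) := (MeasurableEquiv.neg ℝ).measurableEmbedding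
  rw [quarticMean, ← quarticTilt_map_neg, he.integral_map, integral_neg, quarticMean]

theorem tendsto_quarticMean_atBot {a : ℝ} (ha : 0 < a) :
    Tendsto (quarticMean a) atBot atBot := by
  have h : quarticMean a = fun s => -quarticMean a (-s) := by
    ext s
    rw [quarticMean_neg, neg_neg]
  rw [h]
  exact tendsto_neg_atTop_atBot.comp ((tendsto_quarticMean_atTop ha).comp tendsto_neg_atBot_atTop)

theorem quarticTilt_singleton {a : ℝ} (s x : ℝ) : quarticTilt a s {x} = 0 :=
  tilted_absolutelyContinuous _ _ (by simp)

theorem quarticTilt_Ici {a : ℝ} (ha : 0 < a) (x : ℝ) :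
    (quarticTilt a 0).real (Set.Ici x) = cdf (quarticTilt a 0) (-x) := by
  have := isProbabilityMeasure_quarticTilt ha 0
  have h := quarticTilt_map_neg (a := a) 0
  rw [neg_zero] at h
  rw [cdf_eq_real]
  conv_rhs => rw [← h]
  rw [map_measureReal_apply measurable_neg measurableSet_Iic]
  congr 1
  ext y
  simp

theorem continuous_cdf_of_singleton {μ : Measure ℝ} [IsProbabilityMeasure μ]
    (h : ∀ x, μ {x} = 0) : Continuous (cdf μ) := by
  refine continuous_iff_continuousAt.2 fun x => ?_
  refine (monotone_cdf μ).continuousAt_iff_leftLim_eq_rightLim.2 ?_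
  rw [StieltjesFunction.rightLim_eq]
  have h0 := h x
  rw [← measure_cdf μ, StieltjesFunction.measure_singleton, ENNReal.ofReal_eq_zero] at h0
  exact le_antisymm ((monotone_cdf μ).leftLim_le le_rfl) (by linarith)

end QuarticLaw

/-! ### The likelihood equation -/

section Likelihood

/-- The magnetization of a configuration. -/
noncomputable def magnetization {N : ℕ} (x : Config N) : ℝ := (∑ i, spin x i) / N

theorem sum_prod_spin (p : ℕ) {N : ℕ} (x : Config N) :
    ∑ i : Fin p → Fin N, ∏ k : Fin p, spin x (i k) = (∑ i, spin x i) ^ p := by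
  rw [Finset.sum_pow', Fintype.piFinset_univ]

theorem weight_eq {p : ℕ} (hp : 1 ≤ p) (β h : ℝ) {N : ℕ} (hN : N ≠ 0) (x : Config N) :
    weight p β h x = Real.exp (β * (N * magnetization x ^ p) + h * (N * magnetization x)) := by
  have hN' : (N : ℝ) ≠ 0 := Nat.cast_ne_zero.2 hN
  obtain ⟨q, rfl⟩ := Nat.exists_eq_add_of_le' hp
  rw [weight, sum_prod_spin, magnetization, Nat.add_sub_cancel, div_pow]
  congr 2
  · field_simp
    ring
  · field_simp

/-- The expectation of a function of the magnetization under the model. -/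
noncomputable def expectation (p : ℕ) (β h : ℝ) (N : ℕ) (f : ℝ → ℝ) : ℝ :=
  ∑ x : Config N, prob p β h x * f (magnetization x)

instance : MeasurableSingletonClass ℤˣ where
  measurableSet_singleton u :=
    ⟨{(u : ℤ)}, measurableSet_singleton _, by
      ext v
      simp [Units.ext_iff]⟩

theorem model_real_apply (p : ℕ) (β h : ℝ) (N : ℕ) (q : ℝ → Prop) [DecidablePred q] :
    (model p β h N).real {x | q (magnetization x)} =
      expectation p β h N fun v => if q v then 1 else 0 := by
  classical
  rw [measureReal_def, model, PMF.toMeasure_apply_fintype, ENNReal.toReal_sum]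
  · refine Finset.sum_congr rfl fun x _ => ?_
    simp only [Set.indicator_apply, Set.mem_ofPred_eq, modelPMF, PMF.ofFintype_apply]
    split_ifs
    · rw [mul_one, ENNReal.toReal_ofReal (prob_nonneg p β h x)]
    · simp
  · intro x _
    simp only [Set.indicator_apply, modelPMF, PMF.ofFintype_apply]
    split_ifs <;> simp

/-- The tangent line at `b` lies strictly below the sum of exponentials: this is `1 + y < exp y` for
`y ≠ 0`, applied termwise. -/
theorem one_add_lt_sum_exp {ι : Type*} [Fintype ι] (d c : ι → ℝ) {b b' : ℝ} (hb : b' ≠ b)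
    (hd : ∃ i, d i ≠ 0) :
    ∑ i, Real.exp (b * d i + c i) + (b' - b) * ∑ i, d i * Real.exp (b * d i + c i) <
      ∑ i, Real.exp (b' * d i + c i) := by
  have key : ∀ i, Real.exp (b' * d i + c i) =
      Real.exp (b * d i + c i) * Real.exp ((b' - b) * d i) := fun i => by
    rw [← Real.exp_add]; ring_nf
  rw [Finset.mul_sum, ← Finset.sum_add_distrib]
  refine Finset.sum_lt_sum (fun i _ => ?_) ?_
  · rw [key]
    nlinarith [Real.add_one_le_exp ((b' - b) * d i), Real.exp_pos (b * d i + c i)]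
  · obtain ⟨i, hi⟩ := hd
    refine ⟨i, Finset.mem_univ i, ?_⟩
    rw [key]
    nlinarith [Real.add_one_lt_exp (mul_ne_zero (sub_ne_zero.2 hb) hi),
      Real.exp_pos (b * d i + c i)]

theorem sum_mul_exp_le {ι : Type*} [Fintype ι] (d c : ι → ℝ) {b b' : ℝ} (hb : b ≤ b') :
    ∑ i, d i * Real.exp (b * d i + c i) ≤ ∑ i, d i * Real.exp (b' * d i + c i) := by
  refine Finset.sum_le_sum fun i _ => ?_
  rcases le_total 0 (d i) with h | h
  · exact mul_le_mul_of_nonneg_left (Real.exp_le_exp.2 (by nlinarith)) h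
  · exact mul_le_mul_of_nonpos_left (Real.exp_le_exp.2 (by nlinarith)) h

/-- In a one-parameter exponential family, a maximum likelihood estimate lies at or below `b`
exactly when the score at `b` is nonpositive. -/
theorem mle_le_iff {ι : Type*} [Fintype ι] [Nonempty ι] (d c : ι → ℝ) (hd : ∃ i, d i ≠ 0)
    {L : ℝ → ℝ} (hL : ∀ b, L b = (∑ i, Real.exp (b * d i + c i))⁻¹)
    (hbdd : BddAbove (Set.range L)) {e : EReal}
    (he : (∃ b₀ : ℝ, e = (b₀ : EReal) ∧ ∀ b', L b' ≤ L b₀) ∨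
      (e = ⊤ ∧ Tendsto L atTop (𝓝 (⨆ b', L b'))) ∨ (e = ⊥ ∧ Tendsto L atBot (𝓝 (⨆ b', L b'))))
    (b : ℝ) : e ≤ (b : EReal) ↔ 0 ≤ ∑ i, d i * Real.exp (b * d i + c i) := by
  have hpos : ∀ b : ℝ, 0 < ∑ i, Real.exp (b * d i + c i) := fun b =>
    Finset.sum_pos (fun i _ => Real.exp_pos _) Finset.univ_nonempty
  have hlt : ∀ {b b'}, L b' < L b ↔
      ∑ i, Real.exp (b * d i + c i) < ∑ i, Real.exp (b' * d i + c i) := fun {b b'} => by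
    rw [hL, hL, inv_lt_inv₀ (hpos _) (hpos _)]
  have hup : ∀ b b', 0 ≤ ∑ i, d i * Real.exp (b * d i + c i) → b < b' → L b' < L b := by
    intro b b' h hb
    rw [hlt]
    nlinarith [one_add_lt_sum_exp d c hb.ne' hd]
  have hdown : ∀ b b', ∑ i, d i * Real.exp (b * d i + c i) ≤ 0 → b' < b → L b' < L b := by
    intro b b' h hb
    rw [hlt]
    nlinarith [one_add_lt_sum_exp d c hb.ne hd]
  constructor
  · intro hle
    by_contra! hneg
    rcases he with ⟨b₀, rfl, hmax⟩ | ⟨rfl, -⟩ | ⟨rfl, hlim⟩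
    · rcases (EReal.coe_le_coe_iff.1 hle).lt_or_eq with h | rfl
      · exact absurd (hmax b) (not_le.2 (hdown b b₀ hneg.le h))
      · have hmin : IsLocalMin (fun b => ∑ i, Real.exp (b * d i + c i)) b₀ :=
          Eventually.of_forall fun b' => not_lt.1 fun h => not_le.2 (hlt.2 h) (hmax b')
        have hder : HasDerivAt (fun b => ∑ i, Real.exp (b * d i + c i))
            (∑ i, d i * Real.exp (b₀ * d i + c i)) b₀ := by
          refine HasDerivAt.fun_sum fun i _ => ?_
          refine ((((hasDerivAt_id b₀).mul_const (d i)).add_const (c i)).exp).congr_deriv ?_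
          simp only [id]
          ring
        exact hneg.ne (hmin.hasDerivAt_eq_zero hder)
    · simp at hle
    · have h1 : (⨆ b', L b') ≤ L (b - 1) := by
        refine le_of_tendsto hlim ((eventually_lt_atBot (b - 1)).mono fun b' hb' => ?_)
        exact (hdown (b - 1) b' ((sum_mul_exp_le d c (by linarith)).trans hneg.le) hb').le
      exact absurd ((le_ciSup hbdd b).trans h1) (not_le.2 (hdown b _ hneg.le (by linarith)))
  · intro h0
    rcases he with ⟨b₀, rfl, hmax⟩ | ⟨rfl, hlim⟩ | ⟨rfl, -⟩
    · refine EReal.coe_le_coe_iff.2 (not_lt.1 fun h => ?_)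
      exact absurd (hmax b) (not_le.2 (hup b b₀ h0 h))
    · have h1 : (⨆ b', L b') ≤ L (b + 1) := by
        refine le_of_tendsto hlim ((eventually_gt_atTop (b + 1)).mono fun b' hb' => ?_)
        exact (hup (b + 1) b' (h0.trans (sum_mul_exp_le d c (by linarith))) hb').le
      exact absurd ((le_ciSup hbdd b).trans h1) (not_le.2 (hup b _ h0 (by linarith)))
    · exact bot_le

theorem bddAbove_prob (p : ℕ) (h : ℝ) {N : ℕ} (x : Config N) :
    BddAbove (Set.range fun β : ℝ => prob p β h x) := by
  refine ⟨1, ?_⟩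
  rintro _ ⟨β, rfl⟩
  rw [← sum_prob p β h N]
  exact Finset.single_le_sum (f := fun y => prob p β h y) (fun y _ => prob_nonneg p β h y)
    (Finset.mem_univ x)

/-- The all-plus configuration and one with a single flipped spin have magnetizations `1` and `(N -
2) / N ∈ [0, 1)`, whose powers differ. For `N = 1` and even `p` the statistic is constant, hence `N
≥ 2`. -/
theorem exists_magnetization_pow_ne {p : ℕ} (hp : 1 ≤ p) {N : ℕ} (hN : 2 ≤ N) (x : Config N) :
    ∃ y : Config N, magnetization y ^ p ≠ magnetization x ^ p := by
  by_contra! hall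
  have hN' : (2 : ℝ) ≤ N := by exact_mod_cast hN
  have h1 := hall fun _ => 1
  have h2 := hall (Function.update (fun _ => 1) ⟨0, by omega⟩ (-1))
  rw [← h2] at h1
  have e1 : magnetization (fun _ : Fin N => (1 : ℤˣ)) = 1 := by
    simp [magnetization, spin]
    omega
  have e2 : magnetization (Function.update (fun _ : Fin N => (1 : ℤˣ)) ⟨0, by omega⟩ (-1)) =
      (N - 2) / N := by
    rw [magnetization]
    congr 1
    have hs : ∀ i : Fin N, spin (Function.update (fun _ : Fin N => (1 : ℤˣ)) ⟨0, by omega⟩ (-1)) i =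
        1 - if i = ⟨0, by omega⟩ then 2 else 0 := by
      intro i
      by_cases hi : i = ⟨0, by omega⟩
      · subst hi
        simp [spin]
        norm_num
      · simp [spin, hi]
    simp only [hs, Finset.sum_sub_distrib, Finset.sum_ite_eq', Finset.mem_univ, if_true]
    simp
  rw [e1, e2, one_pow] at h1
  have h3 : ((N : ℝ) - 2) / N < 1 := by rw [div_lt_one (by linarith)]; linarith
  have h4 : 0 ≤ ((N : ℝ) - 2) / N := div_nonneg (by linarith) (by linarith)
  exact absurd h1.symm (pow_lt_one₀ h4 h3 (by omega)).ne

theorem expectation_eq (p : ℕ) (β h : ℝ) (N : ℕ) (f : ℝ → ℝ) :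
    expectation p β h N f =
      (∑ y : Config N, weight p β h y * f (magnetization y)) / ∑ y : Config N, weight p β h y := by
  rw [expectation, Finset.sum_div]
  refine Finset.sum_congr rfl fun y _ => ?_
  rw [prob, two_pow_mul_partitionFn]
  ring

/-- The maximum likelihood estimate of `β` lies at or below `b` exactly when the observed sufficient
statistic does not exceed its expectation at `b`. -/
theorem IsBetaMLE.le_iff {p : ℕ} (hp : 1 ≤ p) {h : ℝ} {N : ℕ} (hN : 2 ≤ N) {x : Config N}
    {e : EReal} (he : IsBetaMLE p h x e) (b : ℝ) :
    e ≤ (b : EReal) ↔ magnetization x ^ p ≤ expectation p b h N fun v => v ^ p := by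
  have hN0 : (0 : ℝ) < N := by exact_mod_cast (by omega : 0 < N)
  obtain ⟨d, hd⟩ : ∃ d : Config N → ℝ,
    ∀ y, d y = N * (magnetization y ^ p - magnetization x ^ p) := ⟨_, fun _ => rfl⟩
  obtain ⟨c, hc⟩ : ∃ c : Config N → ℝ,
    ∀ y, c y = h * (N * (magnetization y - magnetization x)) := ⟨_, fun _ => rfl⟩
  have hw : ∀ (β : ℝ) (y : Config N),
      weight p β h y = weight p β h x * Real.exp (β * d y + c y) := by
    intro β y
    rw [weight_eq hp β h (by omega), weight_eq hp β h (by omega), ← Real.exp_add, hd, hc]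
    congr 1
    ring
  have hL : ∀ β : ℝ, prob p β h x = (∑ y, Real.exp (β * d y + c y))⁻¹ := by
    intro β
    rw [prob, two_pow_mul_partitionFn, Finset.sum_congr rfl fun y _ => hw β y, ← Finset.mul_sum,
      div_mul_eq_div_div, div_self (weight_pos p β h x).ne', one_div]
  obtain ⟨y, hy⟩ := exists_magnetization_pow_ne hp hN x
  have hd0 : ∃ y, d y ≠ 0 := ⟨y, by
    rw [hd]
    exact mul_ne_zero hN0.ne' (sub_ne_zero.2 hy)⟩
  rw [mle_le_iff d c hd0 hL (bddAbove_prob p h x) he b, expectation_eq]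
  have hwx := weight_pos p b h x
  have hS := sum_weight_pos p b h N
  have e3 : ∑ y : Config N, d y * Real.exp (b * d y + c y) =
      N / weight p b h x * (∑ y : Config N, weight p b h y * magnetization y ^ p -
        (∑ y : Config N, weight p b h y) * magnetization x ^ p) := by
    rw [Finset.sum_mul, ← Finset.sum_sub_distrib, Finset.mul_sum]
    refine Finset.sum_congr rfl fun y _ => ?_
    rw [hw b y, hd y]
    field_simp
  rw [e3, mul_nonneg_iff_of_pos_left (by positivity), sub_nonneg, le_div_iff₀ hS, mul_comm]

end Likelihood

/-! ### From sums over configurations to integrals of step functions -/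

section Lattice

theorem sum_spin_eq {N : ℕ} (x : Config N) :
    ∑ i, spin x i = 2 * (Finset.univ.filter fun i => x i = 1).card - N := by
  have h : ∀ i, spin x i = 2 * (if x i = 1 then 1 else 0) - 1 := by
    intro i
    rcases Int.units_eq_one_or (x i) with h | h
    · simp [spin, h]
      norm_num
    · simp [spin, h]
  simp only [h, Finset.sum_sub_distrib, ← Finset.mul_sum]
  simp

theorem sum_config_eq (N : ℕ) (f : ℕ → ℝ) :
    ∑ x : Config N, f (Finset.univ.filter fun i => x i = 1).card =
      ∑ k ∈ Finset.range (N + 1), (N.choose k : ℝ) * f k := by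
  have h := Finset.sum_powerset_apply_card f (x := (Finset.univ : Finset (Fin N)))
  simp only [Finset.card_univ, Fintype.card_fin, nsmul_eq_mul] at h
  rw [← h]
  refine Finset.sum_bij' (fun x _ => Finset.univ.filter fun i => x i = 1)
    (fun s _ i => if i ∈ s then 1 else -1) (by simp) (by simp) ?_ ?_ (fun _ _ => rfl)
  · intro x _
    ext1 i
    rcases Int.units_eq_one_or (x i) with h | h <;> simp [h]
  · intro s _
    ext i
    by_cases hi : i ∈ s <;> simp [hi]

/-- Writing lattice sums as integrals over a fixed space makes dominated convergence available. -/
theorem integral_comp_floor (N : ℕ) (f : ℤ → ℝ) (hf : ∀ k : ℤ, ¬(0 ≤ k ∧ k ≤ N) → f k = 0) :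
    ∫ y : ℝ, f ⌊y⌋ = ∑ k ∈ Finset.range (N + 1), f k := by
  have h : ∀ y : ℝ, f ⌊y⌋ = ∑ k ∈ Finset.range (N + 1),
      (Set.Ico (k : ℝ) (k + 1)).indicator (fun _ => f k) y := by
    intro y
    by_cases hy : 0 ≤ ⌊y⌋ ∧ ⌊y⌋ ≤ N
    · obtain ⟨n, hn⟩ := Int.eq_ofNat_of_zero_le hy.1
      have hfl := Int.floor_eq_iff.1 hn
      rw [Finset.sum_eq_single n]
      · rw [Set.indicator_of_mem, hn]
        exact_mod_cast hfl
      · intro b _ hb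
        refine Set.indicator_of_notMem (fun hmem => hb ?_) _
        have : ⌊y⌋ = (b : ℤ) := Int.floor_eq_iff.2 (by exact_mod_cast hmem)
        omega
      · intro hnot
        simp at hnot
        omega
    · rw [hf _ hy, Finset.sum_eq_zero]
      intro b hb
      refine Set.indicator_of_notMem (fun hmem => hy ?_) _
      have : ⌊y⌋ = (b : ℤ) := Int.floor_eq_iff.2 (by exact_mod_cast hmem)
      simp at hb
      omega
  simp_rw [h]
  rw [integral_finsetSum]
  · refine Finset.sum_congr rfl fun k _ => ?_
    rw [integral_indicator_const _ measurableSet_Ico]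
    simp [measureReal_def]
  · intro k _
    exact (integrable_indicator_iff measurableSet_Ico).2 (integrableOn_const (by simp) (by simp))

theorem integral_comp_affine (f : ℝ → ℝ) {a : ℝ} (ha : 0 < a) (b : ℝ) :
    ∫ u : ℝ, f (b + a * u) = a⁻¹ * ∫ y, f y := by
  rw [Measure.integral_comp_mul_left (fun y => f (b + y)) a, integral_add_left_eq_self f b,
    abs_of_pos (inv_pos.2 ha), smul_eq_mul]

/-- The scale `N ^ (1/4)` of the fluctuations of the magnetization. -/
noncomputable def quarterRoot (N : ℕ) : ℝ := (N : ℝ) ^ (1 / 4 : ℝ)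

theorem quarterRoot_pow_four (N : ℕ) : quarterRoot N ^ 4 = N := by
  rw [quarterRoot, ← Real.rpow_natCast, ← Real.rpow_mul (Nat.cast_nonneg N)]
  norm_num

theorem quarterRoot_pow_three (N : ℕ) : quarterRoot N ^ 3 = (N : ℝ) ^ (3 / 4 : ℝ) := by
  rw [quarterRoot, ← Real.rpow_natCast, ← Real.rpow_mul (Nat.cast_nonneg N)]
  norm_num

theorem one_le_quarterRoot {N : ℕ} (hN : 1 ≤ N) : 1 ≤ quarterRoot N :=
  Real.one_le_rpow (by exact_mod_cast hN) (by norm_num)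

theorem tendsto_quarterRoot : Tendsto quarterRoot atTop atTop :=
  (tendsto_rpow_atTop (by norm_num)).comp tendsto_natCast_atTop_atTop

/-- The possible values of the magnetization, indexed by the number of positive spins. -/
noncomputable def latticePoint (N : ℕ) (k : ℤ) : ℝ := (2 * k - N) / N

/-- The index of the lattice point just below `m + u / N ^ (1/4)`. -/
noncomputable def latticeIndex (m : ℝ) (N : ℕ) (u : ℝ) : ℤ :=
  ⌊N * (1 + m) / 2 + quarterRoot N ^ 3 / 2 * u⌋

/-- The binomial weight, normalised by its exponential rate and by `√N`. -/
noncomputable def stirlingFactor (N k : ℕ) : ℝ :=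
  √N / 2 ^ N * N.choose k * Real.exp (N * entropy (latticePoint N k))

/-- The law of the magnetization, up to a constant. -/
noncomputable def localDensity (p : ℕ) (β h m t : ℝ) (N : ℕ) (k : ℤ) : ℝ :=
  if 0 ≤ k ∧ k ≤ N then
    stirlingFactor N k.toNat * Real.exp (N * (H p β h (latticePoint N k) - H p β h m) +
      t * quarterRoot N * (latticePoint N k ^ p - m ^ p))
  else 0

theorem sum_weight_eq {p : ℕ} (hp : 1 ≤ p) (β h m t : ℝ) {N : ℕ} (hN : 1 ≤ N) (F : ℝ → ℝ) :
    ∑ x : Config N, weight p (β + t / quarterRoot N ^ 3) h x * F (magnetization x) =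
      2 ^ N / √N * Real.exp (N * H p β h m + t * quarterRoot N * m ^ p) *
        ∑ k ∈ Finset.range (N + 1),
          localDensity p β h m t N k * F (latticePoint N k) := by
  have hr := one_le_quarterRoot hN
  have hr0 : quarterRoot N ≠ 0 := by positivity
  have hN0 : (0 : ℝ) < N := by exact_mod_cast hN
  have hmag : ∀ x : Config N, magnetization x =
      latticePoint N ((Finset.univ.filter fun i => x i = 1).card : ℕ) := fun x => by
    rw [magnetization, sum_spin_eq, latticePoint]
    push_cast
    rfl
  have hw : ∀ x : Config N, weight p (β + t / quarterRoot N ^ 3) h x * F (magnetization x) =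
      (fun k : ℕ => Real.exp ((β + t / quarterRoot N ^ 3) * (N * latticePoint N k ^ p) +
        h * (N * latticePoint N k)) * F (latticePoint N k))
        (Finset.univ.filter fun i => x i = 1).card := fun x => by
    rw [weight_eq hp _ _ (by omega), hmag]
  rw [Finset.sum_congr rfl fun x _ => hw x, sum_config_eq N fun k : ℕ =>
    Real.exp ((β + t / quarterRoot N ^ 3) * (N * latticePoint N k ^ p) +
        h * (N * latticePoint N k)) * F (latticePoint N k), Finset.mul_sum]
  refine Finset.sum_congr rfl fun k hk => ?_
  have hk : k ≤ N := by simpa [Nat.lt_succ_iff] using hk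
  rw [localDensity, if_pos ⟨by positivity, by exact_mod_cast hk⟩, stirlingFactor, Int.toNat_natCast]
  have hexp : Real.exp ((β + t / quarterRoot N ^ 3) * (N * latticePoint N k ^ p) +
        h * (N * latticePoint N k)) =
      Real.exp (N * H p β h m + t * quarterRoot N * m ^ p) *
        (Real.exp (N * entropy (latticePoint N k)) *
          Real.exp (N * (H p β h (latticePoint N k) - H p β h m) +
      t * quarterRoot N * (latticePoint N k ^ p - m ^ p))) := by
    rw [← Real.exp_add, ← Real.exp_add]
    congr 1
    -- Since `N = quarterRoot N ^ 4`, a shift of `β` of order `N ^ (-3/4)` changes the exponent at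
    -- scale `N ^ (1/4)`, matching the fluctuations of the magnetization.
    have : t / quarterRoot N ^ 3 * N = t * quarterRoot N := by
      rw [← quarterRoot_pow_four N]
      field_simp
    simp only [H]
    linear_combination latticePoint N k ^ p * this
  have hs : √(N : ℝ) ≠ 0 := (Real.sqrt_pos.2 hN0).ne'
  rw [hexp]
  field_simp

theorem integral_localDensity {p : ℕ} (β h m t : ℝ) {N : ℕ} (hN : 1 ≤ N) (F : ℝ → ℝ) :
    ∫ u : ℝ, localDensity p β h m t N (latticeIndex m N u) *
        F (latticePoint N (latticeIndex m N u)) =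
      2 / quarterRoot N ^ 3 * ∑ k ∈ Finset.range (N + 1),
          localDensity p β h m t N k * F (latticePoint N k) := by
  have hr := one_le_quarterRoot hN
  have := integral_comp_affine (fun y => localDensity p β h m t N ⌊y⌋ * F (latticePoint N ⌊y⌋))
    (a := quarterRoot N ^ 3 / 2) (by positivity) (N * (1 + m) / 2)
  simp only [latticeIndex]
  rw [this, integral_comp_floor N (fun k => localDensity p β h m t N k * F (latticePoint N k)),
    inv_div]
  intro k hk
  rw [localDensity, if_neg hk, zero_mul]

/-- The exponential rate, the powers of `N` and the lattice spacing are common to numerator and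
denominator and cancel. -/
theorem expectation_eq_integral_div {p : ℕ} (hp : 1 ≤ p) (β h m t : ℝ) {N : ℕ} (hN : 1 ≤ N)
    (F : ℝ → ℝ) :
    expectation p (β + t / quarterRoot N ^ 3) h N F =
      (∫ u : ℝ, localDensity p β h m t N (latticeIndex m N u) *
        F (latticePoint N (latticeIndex m N u))) /
      ∫ u : ℝ, localDensity p β h m t N (latticeIndex m N u) := by
  have hr := one_le_quarterRoot hN
  have hN0 : (0 : ℝ) < N := by exact_mod_cast hN
  have hs : 0 < √(N : ℝ) := Real.sqrt_pos.2 hN0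
  have h1 := sum_weight_eq hp β h m t hN fun _ => 1
  have h2 := integral_localDensity (p := p) β h m t hN fun _ => 1
  simp only [mul_one] at h1 h2
  rw [expectation_eq, sum_weight_eq hp β h m t hN, h1, integral_localDensity β h m t hN, h2,
    mul_div_mul_left _ _ (by positivity), mul_div_mul_left _ _ (by positivity)]

end Lattice

/-! ### Stirling asymptotics of the binomial weights -/

section Stirling

theorem stirlingSeq_pos {n : ℕ} (hn : n ≠ 0) : 0 < Stirling.stirlingSeq n := by
  obtain ⟨k, rfl⟩ := Nat.exists_eq_succ_of_ne_zero hn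
  exact Stirling.stirlingSeq'_pos k

theorem one_le_stirlingSeq {n : ℕ} (hn : n ≠ 0) : 1 ≤ Stirling.stirlingSeq n :=
  (Real.one_le_sqrt.2 (by linarith [Real.two_le_pi])).trans (Stirling.sqrt_pi_le_stirlingSeq hn)

theorem stirlingSeq_le_one {n : ℕ} (hn : n ≠ 0) :
    Stirling.stirlingSeq n ≤ Stirling.stirlingSeq 1 := by
  obtain ⟨k, rfl⟩ := Nat.exists_eq_succ_of_ne_zero hn
  exact Stirling.stirlingSeq'_antitone (Nat.zero_le k)

theorem factorial_eq_stirlingSeq {n : ℕ} (hn : n ≠ 0) :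
    (n.factorial : ℝ) =
      Stirling.stirlingSeq n * (√(2 * n) * ((n : ℝ) ^ n * Real.exp (-n))) := by
  have hn0 : (0 : ℝ) < n := by exact_mod_cast Nat.pos_of_ne_zero hn
  have hs : 0 < √(2 * n : ℝ) := Real.sqrt_pos.2 (by positivity)
  have he : Real.exp (-n : ℝ) = (Real.exp 1 ^ n)⁻¹ := by
    rw [Real.exp_neg, ← Real.exp_nat_mul, mul_one]
  rw [Stirling.stirlingSeq, he, div_pow]
  field_simp

theorem exp_mul_entropy {k l : ℕ} (hk : k ≠ 0) (hl : l ≠ 0) :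
    Real.exp ((k + l : ℕ) * entropy (latticePoint (k + l) k)) =
      2 ^ (k + l) * ((k : ℝ) ^ k * (l : ℝ) ^ l) / ((k + l : ℕ) : ℝ) ^ (k + l) := by
  have hk0 : (0 : ℝ) < k := by exact_mod_cast Nat.pos_of_ne_zero hk
  have hl0 : (0 : ℝ) < l := by exact_mod_cast Nat.pos_of_ne_zero hl
  have h1 : 1 + latticePoint (k + l) k = 2 * k / (k + l) := by
    rw [latticePoint]; push_cast; field_simp; ring
  have h2 : 1 - latticePoint (k + l) k = 2 * l / (k + l) := by
    rw [latticePoint]; push_cast; field_simp; ring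
  have h3 : ((k + l : ℕ) : ℝ) * entropy (latticePoint (k + l) k) =
      k * Real.log (2 * k / (k + l)) + l * Real.log (2 * l / (k + l)) := by
    rw [entropy, h1, h2]
    push_cast
    field_simp
  rw [h3, Real.exp_add, ← Real.log_pow, ← Real.log_pow, Real.exp_log (by positivity),
    Real.exp_log (by positivity)]
  push_cast
  rw [div_pow, div_pow, mul_pow, mul_pow, pow_add, pow_add]
  field_simp

theorem stirlingFactor_eq {N k : ℕ} (hk : 0 < k) (hkN : k < N) :
    stirlingFactor N k = Stirling.stirlingSeq N /
      (Stirling.stirlingSeq k * Stirling.stirlingSeq (N - k)) /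
        √(2 * ((k / N) * (1 - k / N))) := by
  obtain ⟨l, rfl⟩ := Nat.exists_eq_add_of_lt hkN
  obtain ⟨l, hl, hl'⟩ : ∃ l', l' ≠ 0 ∧ k + l + 1 = k + l' := ⟨l + 1, by omega, by omega⟩
  rw [hl']
  have hk0 : (0 : ℝ) < k := by exact_mod_cast hk
  have hl0 : (0 : ℝ) < l := by exact_mod_cast Nat.pos_of_ne_zero hl
  rw [stirlingFactor, exp_mul_entropy hk.ne' hl, Nat.add_sub_cancel_left,
    Nat.cast_choose ℝ (Nat.le_add_right k l), Nat.add_sub_cancel_left,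
    factorial_eq_stirlingSeq hk.ne', factorial_eq_stirlingSeq hl,
    factorial_eq_stirlingSeq (by omega : k + l ≠ 0)]
  have hek : 0 < Real.exp (-k : ℝ) := Real.exp_pos _
  have hel : 0 < Real.exp (-l : ℝ) := Real.exp_pos _
  have he : Real.exp (-(k + l : ℕ) : ℝ) = Real.exp (-k) * Real.exp (-l) := by
    rw [← Real.exp_add]; congr 1; push_cast; ring
  have hsk := stirlingSeq_pos hk.ne'
  have hsl := stirlingSeq_pos hl
  have hq : √(2 * ((k : ℝ) / (k + l : ℕ) * (1 - k / (k + l : ℕ)))) =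
      √2 * √k * √l / (k + l : ℕ) := by
    have hN : (0 : ℝ) < (k + l : ℕ) := by push_cast; positivity
    have : 2 * ((k : ℝ) / (k + l : ℕ) * (1 - k / (k + l : ℕ))) =
        2 * k * l / ((k + l : ℕ) : ℝ) ^ 2 := by
      field_simp
      push_cast
      ring
    rw [this, Real.sqrt_div (by positivity), Real.sqrt_sq hN.le, Real.sqrt_mul (by positivity),
      Real.sqrt_mul (by positivity)]
  have hN : (0 : ℝ) < (k + l : ℕ) := by push_cast; positivity
  rw [hq, he, Real.sqrt_mul zero_le_two, Real.sqrt_mul zero_le_two, Real.sqrt_mul zero_le_two]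
  have h2 : 0 < √(2 : ℝ) := by positivity
  have h3 : 0 < √(k : ℝ) := by positivity
  have h4 : 0 < √(l : ℝ) := by positivity
  have h5 : √((k + l : ℕ) : ℝ) ^ 2 = (k + l : ℕ) := Real.sq_sqrt hN.le
  generalize √((k + l : ℕ) : ℝ) = a at *
  generalize ((k + l : ℕ) : ℝ) = n at *
  rw [← h5]
  rw [← h5] at hN
  field_simp

theorem stirlingFactor_nonneg (N k : ℕ) : 0 ≤ stirlingFactor N k := by
  unfold stirlingFactor
  positivity

theorem stirlingFactor_le_of_interior {N k : ℕ} {δ : ℝ} (hδ : 0 < δ) (hk : 0 < k) (hkN : k < N)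
    (h : δ ≤ 2 * ((k / N : ℝ) * (1 - k / N))) :
    stirlingFactor N k ≤ Stirling.stirlingSeq 1 / √δ := by
  have h1 := one_le_stirlingSeq hk.ne'
  have h2 := one_le_stirlingSeq (by omega : N - k ≠ 0)
  have h3 := stirlingSeq_le_one (by omega : N ≠ 0)
  have h4 := stirlingSeq_pos (by omega : N ≠ 0)
  rw [stirlingFactor_eq hk hkN]
  exact div_le_div₀ (by linarith)
    ((div_le_self h4.le (one_le_mul_of_one_le_of_one_le h1 h2)).trans h3)
    (Real.sqrt_pos.2 hδ) (Real.sqrt_le_sqrt h)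

/-- A crude bound that also covers the two endpoints, where the Stirling representation is not used:
there the entropy is `log 2` and the factor is exactly `√N`. Inside, `2 k (N - k) / N² ≥ 1 / N`. -/
theorem stirlingFactor_le {N k : ℕ} (hN : 1 ≤ N) (hkN : k ≤ N) :
    stirlingFactor N k ≤ Stirling.stirlingSeq 1 * √N := by
  have hN0 : (0 : ℝ) < N := by exact_mod_cast hN
  have h1 := one_le_stirlingSeq one_ne_zero
  have hs : 0 < √(N : ℝ) := Real.sqrt_pos.2 hN0
  have hent : ∀ x : ℝ, x = 1 ∨ x = -1 → Real.exp (N * entropy x) = 2 ^ N := by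
    intro x hx
    have : entropy x = Real.log 2 := by
      rcases hx with rfl | rfl
      · norm_num [entropy]
        ring
      · norm_num [entropy]
        ring
    rw [this, ← Real.log_pow, Real.exp_log (by positivity)]
  have hend : k = 0 ∨ k = N → stirlingFactor N k = √N := by
    intro hk
    have h1 : N.choose k = 1 := by rcases hk with rfl | rfl <;> simp
    rw [stirlingFactor, h1, hent]
    · push_cast
      field_simp
    · rw [latticePoint]
      rcases hk with rfl | rfl
      · right; push_cast; field_simp; ring
      · left; push_cast; field_simp; ring
  by_cases hk : k = 0 ∨ k = N
  · rw [hend hk]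
    nlinarith
  · push Not at hk
    have hk1 : (1 : ℝ) ≤ k := by exact_mod_cast Nat.one_le_iff_ne_zero.2 hk.1
    have hk2 : (k : ℝ) + 1 ≤ N := by exact_mod_cast lt_of_le_of_ne hkN hk.2
    have := stirlingFactor_le_of_interior (N := N) (k := k) (δ := 1 / N) (by positivity) (by omega)
      (by omega) ?_
    · refine this.trans (le_of_eq ?_)
      rw [Real.sqrt_div zero_le_one, Real.sqrt_one]
      field_simp
    · have : 2 * ((k / N : ℝ) * (1 - k / N)) = 2 * (k * (N - k)) / N / N := by field_simp
      rw [this]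
      gcongr
      rw [le_div_iff₀ hN0]
      nlinarith

theorem tendsto_stirlingFactor {k : ℕ → ℕ} {θ : ℝ} (h0 : 0 < θ) (h1 : θ < 1)
    (hk : Tendsto (fun N => (k N : ℝ) / N) atTop (𝓝 θ)) :
    Tendsto (fun N => stirlingFactor N (k N)) atTop
      (𝓝 (√Real.pi / (√Real.pi * √Real.pi) / √(2 * (θ * (1 - θ))))) := by
  have hlt : ∀ᶠ N : ℕ in atTop, 0 < k N ∧ k N < N := by
    filter_upwards [hk.eventually (lt_mem_nhds h0), hk.eventually (gt_mem_nhds h1),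
      eventually_gt_atTop 0] with N ha hb hN
    have hN0 : (0 : ℝ) < N := by exact_mod_cast hN
    rw [div_lt_one hN0] at hb
    refine ⟨?_, by exact_mod_cast hb⟩
    by_contra hz
    have : k N = 0 := by omega
    simp [this] at ha
  have hkt : Tendsto k atTop atTop := by
    rw [← tendsto_natCast_atTop_iff (R := ℝ)]
    refine (tendsto_natCast_atTop_atTop.atTop_mul_pos h0 hk).congr' ?_
    filter_upwards [eventually_gt_atTop 0] with N hN
    have hN0 : (0 : ℝ) < N := by exact_mod_cast hN
    field_simp
  have hlt' : Tendsto (fun N => N - k N) atTop atTop := by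
    rw [← tendsto_natCast_atTop_iff (R := ℝ)]
    refine (tendsto_natCast_atTop_atTop.atTop_mul_pos (sub_pos.2 h1) (hk.const_sub 1)).congr' ?_
    filter_upwards [eventually_gt_atTop 0, hlt] with N hN hl
    have hN0 : (0 : ℝ) < N := by exact_mod_cast hN
    rw [Nat.cast_sub hl.2.le]
    field_simp
  have hpi : 0 < √Real.pi := Real.sqrt_pos.2 Real.pi_pos
  have hθ : 0 < √(2 * (θ * (1 - θ))) := Real.sqrt_pos.2 (by nlinarith)
  have hS := Stirling.tendsto_stirlingSeq_sqrt_pi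
  refine Tendsto.congr' ?_ ((hS.div ((hS.comp hkt).mul (hS.comp hlt')) (by positivity)).div
    (((hk.mul (hk.const_sub 1)).const_mul 2).sqrt) hθ.ne')
  filter_upwards [hlt] with N hN
  rw [stirlingFactor_eq hN.1 hN.2]
  rfl

end Stirling

/-! ### Local limit theorem and domination -/

section LocalLimit

theorem latticeIndex_bounds (m : ℝ) {N : ℕ} (hN : 1 ≤ N) (u : ℝ) :
    |quarterRoot N * (latticePoint N (latticeIndex m N u) - m) - u| ≤ 2 / quarterRoot N ^ 3 := by
  have hr := one_le_quarterRoot hN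
  have hr4 := quarterRoot_pow_four N
  have h1 := Int.floor_le (N * (1 + m) / 2 + quarterRoot N ^ 3 / 2 * u)
  have h2 := Int.lt_floor_add_one (N * (1 + m) / 2 + quarterRoot N ^ 3 / 2 * u)
  rw [latticePoint, latticeIndex]
  generalize ((⌊N * (1 + m) / 2 + quarterRoot N ^ 3 / 2 * u⌋ : ℤ) : ℝ) = k at *
  rw [← hr4] at *
  generalize quarterRoot N = r at *
  have hr0 : 0 < r := by linarith
  have : r * ((2 * k - r ^ 4) / r ^ 4 - m) - u =
      2 / r ^ 3 * (k - (r ^ 4 * (1 + m) / 2 + r ^ 3 / 2 * u)) := by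
    field_simp
    ring
  rw [this, abs_mul, abs_of_pos (by positivity)]
  refine mul_le_of_le_one_right (by positivity) ?_
  rw [abs_le]
  constructor <;> linarith

theorem tendsto_scaled_latticePoint (m u : ℝ) :
    Tendsto (fun N => quarterRoot N * (latticePoint N (latticeIndex m N u) - m)) atTop (𝓝 u) := by
  rw [tendsto_iff_norm_sub_tendsto_zero]
  refine squeeze_zero' (Eventually.of_forall fun _ => norm_nonneg _)
    ((eventually_ge_atTop 1).mono fun N hN => latticeIndex_bounds m hN u) ?_
  exact Tendsto.const_div_atTop ((tendsto_pow_atTop (by norm_num)).comp tendsto_quarterRoot) 2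

theorem tendsto_of_tendsto_scaled {m u : ℝ} {x : ℕ → ℝ}
    (hx : Tendsto (fun N => quarterRoot N * (x N - m)) atTop (𝓝 u)) :
    Tendsto x atTop (𝓝 m) := by
  have h := (hx.mul (tendsto_inv_atTop_zero.comp tendsto_quarterRoot)).add_const m
  rw [mul_zero, zero_add] at h
  refine h.congr' ?_
  filter_upwards [eventually_ge_atTop 1] with N hN
  have := one_le_quarterRoot hN
  simp only [Function.comp]
  field_simp
  ring

/-- A function that is `c (x - m) ^ j + o((x - m) ^ j)` converges along rescaled sequences. -/
theorem tendsto_scaled_of_isLittleO {m u c : ℝ} {x : ℕ → ℝ} {φ : ℝ → ℝ} {j : ℕ}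
    (hx : Tendsto (fun N => quarterRoot N * (x N - m)) atTop (𝓝 u))
    (hφ : (fun y => φ y - c * (y - m) ^ j) =o[𝓝 m] fun y => (y - m) ^ j) :
    Tendsto (fun N => quarterRoot N ^ j * φ (x N)) atTop (𝓝 (c * u ^ j)) := by
  have h1 := hφ.comp_tendsto (tendsto_of_tendsto_scaled hx)
  have h2 : (fun N => quarterRoot N ^ j * (φ (x N) - c * (x N - m) ^ j)) =o[atTop]
      fun _ => (1 : ℝ) := by
    refine ((Asymptotics.isBigO_refl (fun N => quarterRoot N ^ j) atTop).mul_isLittleO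
      h1).trans_isBigO ?_
    refine ((hx.pow j).isBigO_one ℝ).congr_left fun N => ?_
    simp only [Function.comp]
    rw [mul_pow]
  rw [Asymptotics.isLittleO_one_iff] at h2
  have h3 := h2.add ((hx.pow j).const_mul c)
  rw [zero_add] at h3
  refine h3.congr fun N => ?_
  rw [mul_pow]
  ring

theorem tendsto_scaled_pow_sub {m u : ℝ} {x : ℕ → ℝ} (p : ℕ)
    (hx : Tendsto (fun N => quarterRoot N * (x N - m)) atTop (𝓝 u)) :
    Tendsto (fun N => quarterRoot N * (x N ^ p - m ^ p)) atTop (𝓝 (p * m ^ (p - 1) * u)) := by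
  have h := (hasDerivAt_pow p m).isLittleO
  have := tendsto_scaled_of_isLittleO (φ := fun y => y ^ p - m ^ p) (c := p * m ^ (p - 1))
    (j := 1) hx (by simpa [mul_comm] using h)
  simpa using this

theorem abs_pow_sub_pow_le_mul {x m : ℝ} (hx : |x| ≤ 1) (hm : |m| ≤ 1) (p : ℕ) :
    |x ^ p - m ^ p| ≤ p * |x - m| := by
  refine (abs_pow_sub_pow_le x m p).trans ?_
  have : max |x| |m| ^ (p - 1) ≤ 1 := pow_le_one₀ (le_max_of_le_left (abs_nonneg _)) (max_le hx hm)
  nlinarith [mul_nonneg (abs_nonneg (x - m)) (Nat.cast_nonneg (α := ℝ) p)]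

theorem latticePoint_mem {N : ℕ} (hN : 1 ≤ N) {k : ℤ} (hk : 0 ≤ k ∧ k ≤ N) :
    |latticePoint N k| ≤ 1 := by
  have hN0 : (0 : ℝ) < N := by exact_mod_cast hN
  have h1 : (0 : ℝ) ≤ k := by exact_mod_cast hk.1
  have h2 : (k : ℝ) ≤ N := by exact_mod_cast hk.2
  rw [latticePoint, abs_le, le_div_iff₀ hN0, div_le_iff₀ hN0]
  constructor <;> linarith

/-- Near `m` the factor is bounded. At distance at least `δ` from `m` the crude bound `√N ≤ N` is
paid for by the rescaled fourth power, which is at least `N δ ^ 4`. -/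
theorem stirlingFactor_le_quartic {m : ℝ} (hm : m ∈ Set.Ioo (-1 : ℝ) 1) :
    ∃ C > 0, ∀ N : ℕ, 1 ≤ N → ∀ k : ℕ, k ≤ N →
      stirlingFactor N k ≤ C * (1 + (quarterRoot N * (latticePoint N k - m)) ^ 4) := by
  obtain ⟨δ, hδ, h1, h2⟩ : ∃ δ > 0, -1 + 2 * δ ≤ m ∧ m ≤ 1 - 2 * δ :=
    ⟨min (1 + m) (1 - m) / 2, by
      have : 0 < min (1 + m) (1 - m) := lt_min (by linarith [hm.1]) (by linarith [hm.2])
      linarith, by linarith [min_le_left (1 + m) (1 - m)],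
      by linarith [min_le_right (1 + m) (1 - m)]⟩
  have hs := one_le_stirlingSeq one_ne_zero
  set σ := Stirling.stirlingSeq 1
  refine ⟨max (σ / √(δ ^ 2 / 2)) (σ / δ ^ 4), lt_max_of_lt_right (by positivity),
    fun N hN k hk => ?_⟩
  have hN0 : (0 : ℝ) < N := by exact_mod_cast hN
  have hN1 : (1 : ℝ) ≤ N := by exact_mod_cast hN
  rw [mul_pow, quarterRoot_pow_four]
  have h4 : 0 ≤ (N : ℝ) * (latticePoint N k - m) ^ 4 := by positivity
  by_cases hd : |latticePoint N k - m| < δ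
  · have e1 : (k : ℝ) / N = (1 + latticePoint N k) / 2 := by
      rw [latticePoint]; push_cast; field_simp; ring
    obtain ⟨hd1, hd2⟩ := abs_lt.1 hd
    have hk1 : δ / 2 < (k : ℝ) / N := by rw [e1]; linarith
    have hk2 : (k : ℝ) / N < 1 - δ / 2 := by rw [e1]; linarith
    have hk0 : 0 < k := by
      by_contra hz
      have : k = 0 := by omega
      simp [this] at hk1
      linarith
    have hkN : k < N := by
      have : (k : ℝ) / N < 1 := by linarith
      rw [div_lt_one hN0] at this
      exact_mod_cast this
    refine (stirlingFactor_le_of_interior (δ := δ ^ 2 / 2) (by positivity) hk0 hkN ?_).trans ?_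
    · nlinarith
    · have : 0 < max (σ / √(δ ^ 2 / 2)) (σ / δ ^ 4) := lt_max_of_lt_right (by positivity)
      nlinarith [le_max_left (σ / √(δ ^ 2 / 2)) (σ / δ ^ 4)]
  · have hd4 : δ ^ 4 ≤ (latticePoint N k - m) ^ 4 := by
      rw [← Even.pow_abs (by decide) (latticePoint N k - m)]
      exact pow_le_pow_left₀ hδ.le (not_lt.1 hd) 4
    have hsq : √(N : ℝ) ≤ N := by
      rw [Real.sqrt_le_left (by positivity)]
      nlinarith
    calc stirlingFactor N k ≤ σ * √N := stirlingFactor_le hN hk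
      _ ≤ σ / δ ^ 4 * (N * δ ^ 4) := by
        rw [show σ / δ ^ 4 * (N * δ ^ 4) = σ * N by field_simp]
        gcongr
      _ ≤ max (σ / √(δ ^ 2 / 2)) (σ / δ ^ 4) * (1 + N * (latticePoint N k - m) ^ 4) := by
        gcongr
        · exact le_max_right _ _
        · nlinarith

variable {p : ℕ} {β h m : ℝ}

theorem localDensity_nonneg (p : ℕ) (β h m t : ℝ) (N : ℕ) (k : ℤ) :
    0 ≤ localDensity p β h m t N k := by
  unfold localDensity
  split_ifs
  · exact mul_nonneg (stirlingFactor_nonneg _ _) (Real.exp_pos _).le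
  · exact le_rfl

theorem localDensity_le_at_latticePoint (hp : 3 ≤ p) (hs : IsSpecial p β h)
    (hm : IsUniqueMaximizer p β h m) (t : ℝ) :
    ∃ C > 0, ∃ c > 0, ∀ N : ℕ, 1 ≤ N → ∀ k : ℤ,
      localDensity p β h m t N k ≤ C * Real.exp (
        -c * (quarterRoot N * (latticePoint N k - m)) ^ 4 +
          |t| * p * |quarterRoot N * (latticePoint N k - m)|) := by
  obtain ⟨c, hc, hbound⟩ := hs.exists_quartic_bound hp hm
  obtain ⟨C, hC, hst⟩ := stirlingFactor_le_quartic hm.1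
  -- Half of the quartic decay absorbs the polynomial factor `1 + v ^ 4` coming from the binomial
  -- weights.
  refine ⟨C * (1 + 2 / c), by positivity, c / 2, by positivity, fun N hN k => ?_⟩
  unfold localDensity
  split_ifs with hk
  swap
  · positivity
  have hx := latticePoint_mem hN hk
  obtain ⟨n, rfl⟩ := Int.eq_ofNat_of_zero_le hk.1
  have hst' := hst N hN n (by exact_mod_cast hk.2)
  rw [Int.toNat_natCast]
  have hr := one_le_quarterRoot hN
  have hb := hbound _ (abs_le.1 hx)
  have hpw := abs_pow_sub_pow_le_mul hx
    (abs_le.2 ⟨hm.1.1.le, hm.1.2.le⟩ : |m| ≤ 1) p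
  generalize latticePoint N n = x at *
  set v := quarterRoot N * (x - m) with hv
  have h1 : N * (H p β h x - H p β h m) ≤ -c * v ^ 4 := by
    rw [hv, mul_pow, quarterRoot_pow_four]
    nlinarith [mul_le_mul_of_nonneg_left hb (Nat.cast_nonneg (α := ℝ) N)]
  have h2 : t * quarterRoot N * (x ^ p - m ^ p) ≤ |t| * p * |v| := by
    calc t * quarterRoot N * (x ^ p - m ^ p) ≤ |t * quarterRoot N * (x ^ p - m ^ p)| := le_abs_self _
      _ = |t| * quarterRoot N * |x ^ p - m ^ p| := by
        rw [abs_mul, abs_mul, abs_of_pos (by linarith : 0 < quarterRoot N)]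
      _ ≤ |t| * quarterRoot N * (p * |x - m|) := by gcongr
      _ = |t| * p * |v| := by
        rw [hv, abs_mul, abs_of_pos (by linarith : 0 < quarterRoot N)]; ring
  have h3 : 1 + v ^ 4 ≤ (1 + 2 / c) * Real.exp (c / 2 * v ^ 4) := by
    have h4 : 0 ≤ v ^ 4 := by positivity
    have e1 := Real.add_one_le_exp (c / 2 * v ^ 4)
    have e2 : v ^ 4 = 2 / c * (c / 2 * v ^ 4) := by field_simp
    have e3 : 2 / c * (c / 2 * v ^ 4) ≤ 2 / c * Real.exp (c / 2 * v ^ 4) := by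
      gcongr
      linarith
    have e4 : 0 ≤ c / 2 * v ^ 4 := by positivity
    nlinarith
  calc stirlingFactor N n *
        Real.exp (N * (H p β h x - H p β h m) + t * quarterRoot N * (x ^ p - m ^ p))
      ≤ C * (1 + v ^ 4) * Real.exp (-c * v ^ 4 + |t| * p * |v|) := by
        gcongr
    _ ≤ C * ((1 + 2 / c) * Real.exp (c / 2 * v ^ 4)) * Real.exp (-c * v ^ 4 + |t| * p * |v|) := by
        gcongr
    _ = C * (1 + 2 / c) * Real.exp (-(c / 2) * v ^ 4 + |t| * p * |v|) := by
        rw [mul_assoc, mul_assoc, mul_assoc, ← Real.exp_add]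
        ring_nf

/-- Transfers the bound from the rounded variable `v` to the integration variable `u`, using `u ^ 4
≤ 8 (v ^ 4 + 16)`. -/
theorem exp_quartic_shift_le {c b v u : ℝ} (hc : 0 ≤ c) (hb : 0 ≤ b) (h : |v - u| ≤ 2) :
    Real.exp (-c * v ^ 4 + b * |v|) ≤
      Real.exp (16 * c + 2 * b) * Real.exp (-(c / 8) * u ^ 4 + b * |u|) := by
  rw [← Real.exp_add]
  refine Real.exp_le_exp.2 ?_
  have h1 : |v| ≤ |u| + 2 := by
    have := abs_add_le (v - u) u
    rw [sub_add_cancel] at this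
    linarith
  have h2 : u ^ 4 ≤ 8 * (v ^ 4 + 16) := by
    have hd : (v - u) ^ 2 ≤ 4 := by
      rw [← sq_abs]; nlinarith [abs_nonneg (v - u)]
    have e1 : u ^ 2 ≤ 2 * v ^ 2 + 8 := by nlinarith [sq_nonneg (u - 2 * v)]
    have e2 : u ^ 4 ≤ (2 * v ^ 2 + 8) ^ 2 := by
      have : u ^ 4 = (u ^ 2) ^ 2 := by ring
      rw [this]
      exact pow_le_pow_left₀ (sq_nonneg u) e1 2
    nlinarith [sq_nonneg (v ^ 2 - 4)]
  nlinarith [mul_le_mul_of_nonneg_left h1 hb, mul_le_mul_of_nonneg_left h2 hc]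

/-- The factor `1 + |v|` allows test functions of linear growth, such as the scaled `x ^ p - m ^ p`;
it costs one unit in the linear exponent because `1 + |v| ≤ exp |v|`. -/
theorem exists_integrable_bound (hp : 3 ≤ p) (hs : IsSpecial p β h)
    (hm : IsUniqueMaximizer p β h m) (t : ℝ) {K : ℝ} (hK : 0 ≤ K) :
    ∃ B : ℝ → ℝ, Integrable B ∧ ∀ N : ℕ, 1 ≤ N → ∀ u : ℝ,
      localDensity p β h m t N (latticeIndex m N u) *
        (K * (1 + |quarterRoot N * (latticePoint N (latticeIndex m N u) - m)|)) ≤ B u := by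
  obtain ⟨C, hC, c, hc, hD⟩ := localDensity_le_at_latticePoint hp hs hm t
  refine ⟨fun u => C * K * Real.exp (16 * c + 2 * (|t| * p + 1)) *
    Real.exp (-(c / 8) * u ^ 4 + (|t| * p + 1) * |u|),
    (integrable_exp_quartic_abs (by positivity) _).const_mul _, fun N hN u => ?_⟩
  have h1 := hD N hN (latticeIndex m N u)
  have h2 : |quarterRoot N * (latticePoint N (latticeIndex m N u) - m) - u| ≤ 2 := by
    refine (latticeIndex_bounds m hN u).trans (div_le_self zero_le_two ?_)
    exact one_le_pow₀ (one_le_quarterRoot hN)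
  generalize quarterRoot N * (latticePoint N (latticeIndex m N u) - m) = v at *
  have h3 := exp_quartic_shift_le hc.le (by positivity : 0 ≤ |t| * p + 1) h2
  have h4 : 1 + |v| ≤ Real.exp |v| := by linarith [Real.add_one_le_exp |v|]
  calc localDensity p β h m t N (latticeIndex m N u) * (K * (1 + |v|))
      ≤ C * Real.exp (-c * v ^ 4 + |t| * p * |v|) * (K * Real.exp |v|) := by
        gcongr
    _ = C * K * Real.exp (-c * v ^ 4 + (|t| * p + 1) * |v|) := by
        rw [show -c * v ^ 4 + (|t| * p + 1) * |v| = (-c * v ^ 4 + |t| * p * |v|) + |v| by ring,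
          Real.exp_add (-c * v ^ 4 + |t| * p * |v|)]
        ring
    _ ≤ C * K * (Real.exp (16 * c + 2 * (|t| * p + 1)) *
          Real.exp (-(c / 8) * u ^ 4 + (|t| * p + 1) * |u|)) := by
        gcongr
    _ = _ := by ring

theorem tendsto_localDensity (hs : IsSpecial p β h) (hm : IsUniqueMaximizer p β h m) (t : ℝ) :
    ∃ c₀ > 0, ∀ u : ℝ, Tendsto (fun N => localDensity p β h m t N (latticeIndex m N u)) atTop
      (𝓝 (c₀ * Real.exp (iteratedDeriv 4 (H p β h) m / 24 * u ^ 4 +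
        t * p * m ^ (p - 1) * u))) := by
  have h0 : 0 < (1 + m) / 2 := by linarith [hm.1.1]
  have h1 : (1 + m) / 2 < 1 := by linarith [hm.1.2]
  -- The limit of the Stirling factor at the fraction `(1 + m) / 2` of positive spins; it does not
  -- depend on `u` and cancels in expectations.
  refine ⟨√Real.pi / (√Real.pi * √Real.pi) / √(2 * ((1 + m) / 2 * (1 - (1 + m) / 2))), ?_, ?_⟩
  · have : 0 < √Real.pi := Real.sqrt_pos.2 Real.pi_pos
    have : 0 < √(2 * ((1 + m) / 2 * (1 - (1 + m) / 2))) := Real.sqrt_pos.2 (by nlinarith)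
    positivity
  intro u
  have hv := tendsto_scaled_latticePoint m u
  have hx := tendsto_of_tendsto_scaled hv
  have hθ : Tendsto (fun N => ((latticeIndex m N u : ℤ) : ℝ) / N) atTop (𝓝 ((1 + m) / 2)) := by
    refine ((hx.const_add 1).div_const 2).congr' ?_
    filter_upwards [eventually_ge_atTop 1] with N hN
    have hN0 : (0 : ℝ) < N := by exact_mod_cast hN
    rw [latticePoint]
    field_simp
    ring
  have hrange : ∀ᶠ N : ℕ in atTop, 0 ≤ latticeIndex m N u ∧ latticeIndex m N u ≤ N := by
    filter_upwards [hθ.eventually (lt_mem_nhds h0), hθ.eventually (gt_mem_nhds h1),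
      eventually_gt_atTop 0] with N ha hb hN
    have hN0 : (0 : ℝ) < N := by exact_mod_cast hN
    rw [div_lt_one hN0] at hb
    rw [lt_div_iff₀ hN0, zero_mul] at ha
    exact ⟨by exact_mod_cast ha.le, by exact_mod_cast hb.le⟩
  have hk : Tendsto (fun N => ((latticeIndex m N u).toNat : ℝ) / N) atTop (𝓝 ((1 + m) / 2)) := by
    refine hθ.congr' ?_
    filter_upwards [hrange] with N hN
    have : (((latticeIndex m N u).toNat : ℤ) : ℝ) = latticeIndex m N u := by
      rw [Int.toNat_of_nonneg hN.1]
    rw [← this, Int.cast_natCast]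
  have hst := tendsto_stirlingFactor h0 h1 hk
  have hH := tendsto_scaled_of_isLittleO hv (hs.isLittleO hm)
  have hP := (tendsto_scaled_pow_sub p hv).const_mul t
  have hexp := (Real.continuous_exp.tendsto _).comp (hH.add hP)
  have he : t * (p * m ^ (p - 1) * u) = t * p * m ^ (p - 1) * u := by ring
  rw [he] at hexp
  refine (hst.mul hexp).congr' ?_
  filter_upwards [hrange] with N hN
  rw [localDensity, if_pos hN, Function.comp_apply, quarterRoot_pow_four, mul_assoc t]

end LocalLimit

/-! ### Limits of expectations and of the likelihood event -/

section Expectation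

variable {p : ℕ} {β h m : ℝ}

theorem quarticLaw_eq (p : ℕ) (β h m t : ℝ) :
    quarticLaw p β h m t 0 =
      quarticTilt (-iteratedDeriv 4 (H p β h) m / 24) (t * p * m ^ (p - 1)) := by
  rw [quarticLaw, quarticTilt]
  congr 1
  ext x
  ring

/-- Convergence is required along every sequence with rescaled limit `u`, so that the rounding to
the lattice is harmless, and only for almost every `u`, so that indicators with a moving threshold
qualify. -/
theorem tendsto_integral_localDensity_mul (hp : 3 ≤ p) (hs : IsSpecial p β h)
    (hm : IsUniqueMaximizer p β h m) {t c₀ : ℝ}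
    (hc₀ : ∀ u : ℝ, Tendsto (fun N => localDensity p β h m t N (latticeIndex m N u)) atTop
      (𝓝 (c₀ * Real.exp (iteratedDeriv 4 (H p β h) m / 24 * u ^ 4 +
        t * p * m ^ (p - 1) * u))))
    {F : ℕ → ℝ → ℝ} {g : ℝ → ℝ} {K : ℝ} (hK : 0 ≤ K)
    (hF : ∀ N : ℕ, 1 ≤ N → ∀ x, |x| ≤ 1 → |F N x| ≤ K * (1 + |quarterRoot N * (x - m)|))
    (hlim : ∀ᵐ u : ℝ, ∀ x : ℕ → ℝ,
      Tendsto (fun N => quarterRoot N * (x N - m)) atTop (𝓝 u) →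
        Tendsto (fun N => F N (x N)) atTop (𝓝 (g u))) :
    Tendsto (fun N => ∫ u : ℝ, localDensity p β h m t N (latticeIndex m N u) *
        F N (latticePoint N (latticeIndex m N u))) atTop
      (𝓝 (∫ u : ℝ, c₀ * Real.exp (iteratedDeriv 4 (H p β h) m / 24 * u ^ 4 +
        t * p * m ^ (p - 1) * u) * g u)) := by
  obtain ⟨B, hB, hbound⟩ := exists_integrable_bound hp hs hm t hK
  refine tendsto_integral_filter_of_dominated_convergence B ?_ ?_ hB ?_
  · refine Eventually.of_forall fun N => Measurable.aestronglyMeasurable ?_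
    have hk : Measurable (latticeIndex m N) := Int.measurable_floor.comp (by fun_prop)
    exact (measurable_from_top (f := fun k : ℤ => localDensity p β h m t N k *
      F N (latticePoint N k))).comp hk
  · filter_upwards [eventually_ge_atTop 1] with N hN
    refine Eventually.of_forall fun u => le_trans ?_ (hbound N hN u)
    have hD := localDensity_nonneg p β h m t N (latticeIndex m N u)
    rw [norm_mul, Real.norm_eq_abs, abs_of_nonneg hD, Real.norm_eq_abs]
    by_cases hk : 0 ≤ latticeIndex m N u ∧ latticeIndex m N u ≤ N
    · exact mul_le_mul_of_nonneg_left (hF N hN _ (latticePoint_mem hN hk)) hD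
    · rw [localDensity, if_neg hk, zero_mul, zero_mul]
  · filter_upwards [hlim] with u hu
    exact (hc₀ u).mul (hu _ (tendsto_scaled_latticePoint m u))

/-- Expectations of functions of the rescaled magnetization, under parameters at distance
`t N ^ (-3/4)` from a special point, converge to expectations under the quartic law. -/
theorem tendsto_expectation (hp : 3 ≤ p) (hs : IsSpecial p β h)
    (hm : IsUniqueMaximizer p β h m) (t : ℝ)
    {F : ℕ → ℝ → ℝ} {g : ℝ → ℝ} {K : ℝ} (hK : 0 ≤ K)
    (hF : ∀ N : ℕ, 1 ≤ N → ∀ x, |x| ≤ 1 → |F N x| ≤ K * (1 + |quarterRoot N * (x - m)|))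
    (hlim : ∀ᵐ u : ℝ, ∀ x : ℕ → ℝ,
      Tendsto (fun N => quarterRoot N * (x N - m)) atTop (𝓝 u) →
        Tendsto (fun N => F N (x N)) atTop (𝓝 (g u))) :
    Tendsto (fun N => expectation p (β + t / quarterRoot N ^ 3) h N (F N)) atTop
      (𝓝 (∫ u, g u ∂(quarticLaw p β h m t 0))) := by
  obtain ⟨c₀, hc, hc₀⟩ := tendsto_localDensity hs hm t
  have hnum := tendsto_integral_localDensity_mul hp hs hm hc₀ hK hF hlim
  have hden := tendsto_integral_localDensity_mul hp hs hm hc₀ (F := fun _ _ => 1)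
    (g := fun _ => 1) zero_le_one
    (fun N _ x _ => by
      rw [abs_one, one_mul]
      linarith [abs_nonneg (quarterRoot N * (x - m))])
    (Eventually.of_forall fun _ _ _ => tendsto_const_nhds)
  have ha : 0 < -iteratedDeriv 4 (H p β h) m / 24 := by
    linarith [hs.iteratedDeriv_four_neg hp hm]
  have hint := integrable_exp_quartic ha (t * p * m ^ (p - 1))
  have hZ : 0 < ∫ u : ℝ, Real.exp (iteratedDeriv 4 (H p β h) m / 24 * u ^ 4 +
      t * p * m ^ (p - 1) * u) := by
    refine integral_exp_pos (hint.congr (Eventually.of_forall fun x => ?_))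
    ring_nf
  simp only [mul_one, integral_const_mul] at hden
  have hlimit : ∫ u, g u ∂(quarticLaw p β h m t 0) =
      (∫ u : ℝ, c₀ * Real.exp (iteratedDeriv 4 (H p β h) m / 24 * u ^ 4 +
        t * p * m ^ (p - 1) * u) * g u) /
      (c₀ * ∫ u : ℝ, Real.exp (iteratedDeriv 4 (H p β h) m / 24 * u ^ 4 +
        t * p * m ^ (p - 1) * u)) := by
    rw [quarticLaw, integral_tilted]
    simp only [add_zero, smul_eq_mul, mul_assoc c₀, integral_const_mul]
    rw [mul_div_mul_left _ _ hc.ne', ← integral_div]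
    congr 1
    ext u
    ring
  rw [hlimit]
  refine (hnum.div hden (by positivity)).congr' ?_
  filter_upwards [eventually_ge_atTop 1] with N hN
  rw [expectation_eq_integral_div (by omega) β h m t hN]
  rfl

theorem expectation_scaled (p : ℕ) (β h : ℝ) (N : ℕ) (f : ℝ → ℝ) (a b : ℝ) :
    expectation p β h N (fun x => a * (f x - b)) = a * (expectation p β h N f - b) := by
  have h1 := sum_prob p β h N
  simp only [expectation]
  have : a * (∑ x : Config N, prob p β h x * f (magnetization x) - b) =
      a * (∑ x : Config N, prob p β h x * f (magnetization x) -
        (∑ x : Config N, prob p β h x) * b) := by rw [h1, one_mul]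
  rw [this, Finset.sum_mul, ← Finset.sum_sub_distrib, Finset.mul_sum]
  refine Finset.sum_congr rfl fun x _ => ?_
  ring

theorem abs_scaled_pow_sub_le {x : ℝ} (hx : |x| ≤ 1) (hm : |m| ≤ 1) (p : ℕ) {N : ℕ} (hN : 1 ≤ N) :
    |quarterRoot N * (x ^ p - m ^ p)| ≤ p * (1 + |quarterRoot N * (x - m)|) := by
  have hr := one_le_quarterRoot hN
  have h1 := abs_pow_sub_pow_le_mul hx hm p
  rw [abs_mul, abs_mul, abs_of_pos (by linarith : 0 < quarterRoot N)]
  have h2 : quarterRoot N * |x ^ p - m ^ p| ≤ quarterRoot N * (p * |x - m|) := by gcongr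
  have h3 : (0 : ℝ) ≤ p := Nat.cast_nonneg p
  linarith

theorem tendsto_scaled_expectation_pow (hp : 3 ≤ p) (hs : IsSpecial p β h)
    (hm : IsUniqueMaximizer p β h m) (t : ℝ) :
    Tendsto (fun N => quarterRoot N *
        (expectation p (β + t / quarterRoot N ^ 3) h N (fun x => x ^ p) - m ^ p)) atTop
      (𝓝 (p * m ^ (p - 1) * ∫ u, u ∂(quarticLaw p β h m t 0))) := by
  have := tendsto_expectation hp hs hm t (F := fun N x => quarterRoot N * (x ^ p - m ^ p))
    (g := fun u => p * m ^ (p - 1) * u) (K := p) (Nat.cast_nonneg p)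
    (fun N hN x hx => abs_scaled_pow_sub_le hx (abs_le.2 ⟨hm.1.1.le, hm.1.2.le⟩) p hN)
    (Eventually.of_forall fun u x hx => tendsto_scaled_pow_sub p hx)
  rw [integral_const_mul] at this
  exact this.congr fun N => expectation_scaled _ _ _ _ _ _ _

theorem tendsto_ite_le {α : Type*} {l : Filter α} {f g : α → ℝ} {a b : ℝ} (hf : Tendsto f l (𝓝 a))
    (hg : Tendsto g l (𝓝 b)) (hab : a ≠ b) :
    Tendsto (fun i => if f i ≤ g i then (1 : ℝ) else 0) l (𝓝 (if a ≤ b then 1 else 0)) := by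
  rcases lt_or_gt_of_ne hab with hlt | hgt
  · rw [if_pos hlt.le]
    refine tendsto_const_nhds.congr' ?_
    filter_upwards [hf.eventually_lt hg hlt] with i hi
    rw [if_pos hi.le]
  · rw [if_neg (not_le.2 hgt)]
    refine tendsto_const_nhds.congr' ?_
    filter_upwards [hg.eventually_lt hf hgt] with i hi
    rw [if_neg (not_le.2 hi)]

/-- The probability is under the unshifted `β`, the threshold under the shifted parameter. After
subtracting `m ^ p` and scaling, both sides converge, with the common factor `p m ^ (p - 1)`; its
sign decides which half-line the limiting event is. -/
theorem tendsto_prob_pow_le (hp : 3 ≤ p) (hs : IsSpecial p β h)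
    (hm : IsUniqueMaximizer p β h m) (t : ℝ) :
    Tendsto (fun N => (model p β h N).real {x | magnetization x ^ p ≤
        expectation p (β + t / quarterRoot N ^ 3) h N fun v => v ^ p}) atTop
      (𝓝 (cdf (quarticLaw p β h m 0 0)
        (Real.sign (m ^ (p - 1)) * ∫ u, u ∂(quarticLaw p β h m t 0)))) := by
  have ha : 0 < -iteratedDeriv 4 (H p β h) m / 24 := by
    linarith [hs.iteratedDeriv_four_neg hp hm]
  have hm0 : m ^ (p - 1) ≠ 0 := pow_ne_zero _ (hs.ne_zero hp hm)
  have hp0 : (0 : ℝ) < p := by exact_mod_cast (by omega : 0 < p)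
  set M := ∫ u, u ∂(quarticLaw p β h m t 0) with hM
  have hE := tendsto_scaled_expectation_pow hp hs hm t
  rw [← hM] at hE
  have hQ : quarticLaw p β h m 0 0 = quarticTilt (-iteratedDeriv 4 (H p β h) m / 24) 0 := by
    rw [quarticLaw_eq, zero_mul, zero_mul]
  have := isProbabilityMeasure_quarticTilt ha 0
  have hprob : IsProbabilityMeasure (quarticLaw p β h m 0 0) := by rwa [hQ]
  have hlim := tendsto_expectation hp hs hm 0
    (F := fun N v => if v ^ p ≤ expectation p (β + t / quarterRoot N ^ 3) h N (fun v => v ^ p)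
      then 1 else 0)
    (g := fun u => if p * m ^ (p - 1) * u ≤ p * m ^ (p - 1) * M then 1 else 0)
    (K := 1) zero_le_one
    (fun N _ x _ => by
      have : 0 ≤ |quarterRoot N * (x - m)| := abs_nonneg _
      rw [one_mul]
      split_ifs
      · rw [abs_one]; linarith
      · rw [abs_zero]; linarith) ?_
  · have hint : ∫ u, (if p * m ^ (p - 1) * u ≤ p * m ^ (p - 1) * M then (1 : ℝ) else 0)
          ∂(quarticLaw p β h m 0 0) =
        cdf (quarticLaw p β h m 0 0) (Real.sign (m ^ (p - 1)) * M) := by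
      rcases lt_or_gt_of_ne hm0 with hneg | hpos
      · have hk : p * m ^ (p - 1) < 0 := mul_neg_of_pos_of_neg hp0 hneg
        have : (fun u : ℝ => if p * m ^ (p - 1) * u ≤ p * m ^ (p - 1) * M then (1 : ℝ) else 0) =
            (Set.Ici M).indicator 1 := by
          ext u
          simp only [Set.indicator_apply, Set.mem_Ici, Pi.one_apply, mul_le_mul_left_of_neg hk]
        rw [this, integral_indicator_one measurableSet_Ici, Real.sign_of_neg hneg, hQ,
          quarticTilt_Ici ha, neg_one_mul]
      · have hk : 0 < p * m ^ (p - 1) := mul_pos hp0 hpos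
        have : (fun u : ℝ => if p * m ^ (p - 1) * u ≤ p * m ^ (p - 1) * M then (1 : ℝ) else 0) =
            (Set.Iic M).indicator 1 := by
          ext u
          simp only [Set.indicator_apply, Set.mem_Iic, Pi.one_apply, mul_le_mul_iff_right₀ hk]
        rw [this, integral_indicator_one measurableSet_Iic, Real.sign_of_pos hpos, one_mul,
          cdf_eq_real]
    rw [← hint]
    refine hlim.congr fun N => ?_
    rw [zero_div, add_zero]
    exact (model_real_apply p β h N fun v =>
      v ^ p ≤ expectation p (β + t / quarterRoot N ^ 3) h N fun v => v ^ p).symm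
  · have hne : ∀ᵐ u : ℝ, u ≠ M := by
      simp [ae_iff]
    filter_upwards [hne] with u hu x hx
    have hx' := tendsto_scaled_pow_sub p hx
    refine (tendsto_ite_le hx' hE ?_).congr' ?_
    · exact fun he => hu (mul_left_cancel₀ (mul_ne_zero hp0.ne' hm0) he)
    · filter_upwards [eventually_ge_atTop 1] with N hN
      have hr : 0 < quarterRoot N := by linarith [one_le_quarterRoot hN]
      simp only [mul_le_mul_iff_right₀ hr, sub_le_sub_iff_right]

end Expectation

/-! ### Convergence in distribution on the extended real line -/

section ExtendedReals

/-- The lower half-lines of the extended real line with real end points, with `∅` and the whole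
line. -/
def lowerHalfLines : Set (Set EReal) :=
  {s | s = ∅ ∨ s = Set.univ ∨ ∃ a : ℝ, s = Set.Iic (a : EReal)}

theorem lowerHalfLines_total {s t : Set EReal} (hs : s ∈ lowerHalfLines)
    (ht : t ∈ lowerHalfLines) : s ⊆ t ∨ t ⊆ s := by
  rcases hs with rfl | rfl | ⟨a, rfl⟩
  · simp
  · simp
  · rcases ht with rfl | rfl | ⟨b, rfl⟩
    · simp
    · simp
    · rcases le_total (a : EReal) b with h | h
      · exact Or.inl (Set.Iic_subset_Iic.2 h)
      · exact Or.inr (Set.Iic_subset_Iic.2 h)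

theorem measurableSet_of_mem_lowerHalfLines {s : Set EReal} (hs : s ∈ lowerHalfLines) :
    MeasurableSet s := by
  rcases hs with rfl | rfl | ⟨a, rfl⟩
  · exact MeasurableSet.empty
  · exact MeasurableSet.univ
  · exact measurableSet_Iic

/-- Probability measures on the extended real line converge weakly if their values on all
half-lines `[-∞, a]` with real `a` do. -/
theorem tendsto_probabilityMeasure_of_tendsto_Iic {ι : Type*} {l : Filter ι}
    [l.IsCountablyGenerated] {μ : ι → ProbabilityMeasure EReal} {ν : ProbabilityMeasure EReal}
    (h : ∀ a : ℝ, Tendsto (fun i => (μ i : Measure EReal).real (Set.Iic (a : EReal))) l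
      (𝓝 ((ν : Measure EReal).real (Set.Iic (a : EReal))))) :
    Tendsto μ l (𝓝 ν) := by
  have hL : ∀ s ∈ lowerHalfLines, Tendsto (fun i => (μ i : Measure EReal).real s) l
      (𝓝 ((ν : Measure EReal).real s)) := by
    rintro s (rfl | rfl | ⟨a, rfl⟩)
    · simpa using tendsto_const_nhds
    · simpa using tendsto_const_nhds
    · exact h a
  have hinter : ∀ s ∈ lowerHalfLines, ∀ t ∈ lowerHalfLines, s ∩ t ∈ lowerHalfLines := by
    intro s hs t ht
    rcases lowerHalfLines_total hs ht with h | h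
    · rwa [Set.inter_eq_left.2 h]
    · rwa [Set.inter_eq_right.2 h]
  have hunion : ∀ s ∈ lowerHalfLines, ∀ t ∈ lowerHalfLines, s ∪ t ∈ lowerHalfLines := by
    intro s hs t ht
    rcases lowerHalfLines_total hs ht with h | h
    · rwa [Set.union_eq_right.2 h]
    · rwa [Set.union_eq_left.2 h]
  have hIic : ∀ a : ℝ, Set.Iic (a : EReal) ∈ lowerHalfLines := fun a => Or.inr (Or.inr ⟨a, rfl⟩)
  -- Differences of half-lines include `[-∞, a]`, `(a, b]` and `(a, ∞]`, hence neighbourhoods of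
  -- every point including the infinite ones. They are closed under intersection because half-lines
  -- are closed under intersection and union.
  have hpi : IsPiSystem (Set.image2 (fun s t => s \ t) lowerHalfLines lowerHalfLines) := by
    rintro _ ⟨s, hs, t, ht, rfl⟩ _ ⟨s', hs', t', ht', rfl⟩ -
    refine ⟨s ∩ s', hinter s hs s' hs', t ∪ t', hunion t ht t' ht', ?_⟩
    ext x
    simp only [Set.mem_sdiff, Set.mem_inter_iff, Set.mem_union]
    tauto
  refine hpi.tendsto_probabilityMeasure_of_tendsto_of_mem ?_ ?_ ?_
  · rintro _ ⟨s, hs, t, ht, rfl⟩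
    exact (measurableSet_of_mem_lowerHalfLines hs).diff (measurableSet_of_mem_lowerHalfLines ht)
  · intro u hu x hx
    have hxu := hu.mem_nhds hx
    induction x with
    | bot =>
      obtain ⟨a, ha⟩ := EReal.mem_nhds_bot_iff.1 hxu
      refine ⟨_, ⟨Set.Iic ((a - 1 : ℝ) : EReal), hIic _, ∅, Or.inl rfl, rfl⟩, ?_, ?_⟩
      · simpa using Iic_mem_nhds (EReal.bot_lt_coe (a - 1))
      · intro y hy
        refine ha (lt_of_le_of_lt (b := ((a - 1 : ℝ) : EReal)) (by simpa using hy) ?_)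
        exact EReal.coe_lt_coe_iff.2 (by linarith)
    | top =>
      obtain ⟨a, ha⟩ := EReal.mem_nhds_top_iff.1 hxu
      refine ⟨_, ⟨Set.univ, Or.inr (Or.inl rfl), Set.Iic (a : EReal), hIic _, rfl⟩, ?_, ?_⟩
      · filter_upwards [Ioi_mem_nhds (EReal.coe_lt_top a)] with y hy
        simpa using hy
      · intro y hy
        exact ha (by simpa using hy)
    | coe x =>
      obtain ⟨c, d, hcd, hsub⟩ := (mem_nhds_iff_exists_Ioo_subset' ⟨⊥, EReal.bot_lt_coe x⟩
        ⟨⊤, EReal.coe_lt_top x⟩).1 hxu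
      obtain ⟨a, ha1, ha2⟩ := EReal.lt_iff_exists_real_btwn.1 hcd.1
      obtain ⟨b, hb1, hb2⟩ := EReal.lt_iff_exists_real_btwn.1 hcd.2
      refine ⟨_, ⟨Set.Iic (b : EReal), hIic _, Set.Iic (a : EReal), hIic _, rfl⟩, ?_, ?_⟩
      · filter_upwards [Ioo_mem_nhds ha2 hb1] with y hy
        exact ⟨hy.2.le, not_le.2 hy.1⟩
      · intro y hy
        exact hsub ⟨ha1.trans (not_le.1 hy.2), lt_of_le_of_lt hy.1 hb2⟩
  · rintro _ ⟨s, hs, t, ht, rfl⟩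
    have key : Tendsto (fun i => (μ i : Measure EReal).real (s \ t)) l
        (𝓝 ((ν : Measure EReal).real (s \ t))) := by
      rcases lowerHalfLines_total hs ht with h | h
      · simpa [Set.sdiff_eq_empty.2 h] using tendsto_const_nhds
      · have hd : ∀ ρ : ProbabilityMeasure EReal, (ρ : Measure EReal).real (s \ t) =
            (ρ : Measure EReal).real s - (ρ : Measure EReal).real t := fun ρ =>
          measureReal_sdiff h (measurableSet_of_mem_lowerHalfLines ht)
        simp only [hd]
        exact (hL s hs).sub (hL t ht)
    simpa using key

theorem tendstoInDistribution_ereal {Ω : ℕ → Type*} [∀ n, MeasurableSpace (Ω n)]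
    {μ : ∀ n, Measure (Ω n)} [∀ n, IsProbabilityMeasure (μ n)] {X : ∀ n, Ω n → EReal}
    (hX : ∀ n, Measurable (X n)) {G : Measure ℝ} [IsProbabilityMeasure G]
    (h : ∀ a : ℝ, Tendsto (fun n => (μ n).real {ω | X n ω ≤ (a : EReal)}) atTop (𝓝 (cdf G a))) :
    TendstoInDistribution X atTop (fun y : ℝ => (y : EReal)) μ G where
  forall_aemeasurable n := (hX n).aemeasurable
  aemeasurable_limit := measurable_coe_real_ereal.aemeasurable
  tendsto := by
    refine tendsto_probabilityMeasure_of_tendsto_Iic fun a => ?_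
    simp only [ProbabilityMeasure.coe_mk]
    rw [map_measureReal_apply measurable_coe_real_ereal measurableSet_Iic]
    simp only [map_measureReal_apply (hX _) measurableSet_Iic]
    have : (fun y : ℝ => (y : EReal)) ⁻¹' Set.Iic (a : EReal) = Set.Iic a := by
      ext y
      simp
    rw [this, ← cdf_eq_real]
    exact h a

theorem coe_mul_sub_le_iff {r : ℝ} (hr : 0 < r) (b : EReal) (β t : ℝ) :
    (r : EReal) * (b - β) ≤ t ↔ b ≤ ((β + t / r : ℝ) : EReal) := by
  induction b with
  | bot => simp [EReal.coe_mul_bot_of_pos hr]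
  | top =>
    rw [EReal.top_sub_coe, EReal.coe_mul_top_of_pos hr]
    simp only [top_le_iff, EReal.coe_ne_top]
  | coe b =>
    rw [← EReal.coe_sub, ← EReal.coe_mul, EReal.coe_le_coe_iff, EReal.coe_le_coe_iff, mul_comm,
      ← le_div_iff₀ hr, sub_le_iff_le_add']

/-- If `F` is a continuous distribution function and `M` is continuous, nondecreasing and onto,
then `F ∘ M` is a distribution function. -/
theorem exists_measure_cdf_comp {μ : Measure ℝ} (hc : Continuous (cdf μ)) {M : ℝ → ℝ}
    (hM : Continuous M) (hmono : Monotone M) (htop : Tendsto M atTop atTop)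
    (hbot : Tendsto M atBot atBot) :
    ∃ (G : Measure ℝ) (_ : IsProbabilityMeasure G), ∀ t, cdf G t = cdf μ (M t) := by
  let f : StieltjesFunction ℝ :=
    ⟨fun t => cdf μ (M t), (monotone_cdf μ).comp hmono,
      fun x => (hc.comp hM).continuousAt.continuousWithinAt⟩
  have h0 : Tendsto f atBot (𝓝 0) := (tendsto_cdf_atBot μ).comp hbot
  have h1 : Tendsto f atTop (𝓝 1) := (tendsto_cdf_atTop μ).comp htop
  refine ⟨f.measure, f.isProbabilityMeasure h0 h1, fun t => ?_⟩
  rw [cdf_measure_stieltjesFunction f h0 h1]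

/-- Oddness of the mean absorbs the sign into the slope, so the argument of `F_{0,0}` is
nondecreasing in `t` whatever the sign of `m ^ (p - 1)`. -/
theorem sign_mul_quarticMean {a c : ℝ} (hc : c ≠ 0) (t : ℝ) :
    Real.sign c * quarticMean a (t * c) = quarticMean a (t * |c|) := by
  rcases lt_or_gt_of_ne hc with h | h
  · rw [Real.sign_of_neg h, abs_of_neg h, mul_neg, quarticMean_neg, neg_one_mul]
  · rw [Real.sign_of_pos h, abs_of_pos h, one_mul]

end ExtendedReals

end CurieWeiss

/-! ### The limit law of the maximum likelihood estimate -/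

theorem theorem2p6 (p : ℕ) (hp : 3 ≤ p) (β h : ℝ) (hspecial : CurieWeiss.IsSpecial p β h)
    (m : ℝ) (hm : CurieWeiss.IsUniqueMaximizer p β h m)
    (betaHat : (N : ℕ) → CurieWeiss.Config N → EReal)
    (hbetaHat : ∀ (N : ℕ) (x : CurieWeiss.Config N),
      CurieWeiss.IsBetaMLE p h x (betaHat N x)) :
    (∀ t : ℝ, IsProbabilityMeasure (CurieWeiss.quarticLaw p β h m t 0) ∧
      Integrable (fun u : ℝ => u) (CurieWeiss.quarticLaw p β h m t 0)) ∧
    ∃ (G₂ : Measure ℝ) (_ : IsProbabilityMeasure G₂),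
      (∀ t : ℝ, cdf G₂ t = cdf (CurieWeiss.quarticLaw p β h m 0 0)
        (Real.sign (m ^ (p - 1)) * ∫ u, u ∂(CurieWeiss.quarticLaw p β h m t 0))) ∧
      TendstoInDistribution
        (fun (N : ℕ) (x : CurieWeiss.Config N) =>
          (((N : ℝ) ^ (3 / 4 : ℝ) : ℝ) : EReal) * (betaHat N x - (β : EReal)))
        atTop (fun y : ℝ => (y : EReal)) (fun N => CurieWeiss.model p β h N) G₂ := by
  open CurieWeiss in
  have ha : 0 < -iteratedDeriv 4 (H p β h) m / 24 := by
    linarith [hspecial.iteratedDeriv_four_neg hp hm]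
  have hprob := isProbabilityMeasure_quarticTilt ha
  have hm0 : m ^ (p - 1) ≠ 0 := pow_ne_zero _ (hspecial.ne_zero hp hm)
  have hp0 : (0 : ℝ) < p := by exact_mod_cast (by omega : 0 < p)
  refine ⟨fun t => ?_, ?_⟩
  · rw [quarticLaw_eq]
    exact ⟨hprob _, integrable_id_quarticTilt ha _⟩
  have hmean : ∀ t, Real.sign (m ^ (p - 1)) * ∫ u, u ∂(quarticLaw p β h m t 0) =
      quarticMean (-iteratedDeriv 4 (H p β h) m / 24) (t * p * |m ^ (p - 1)|) := by
    intro t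
    rw [quarticLaw_eq, ← sign_mul_quarticMean hm0, quarticMean]
  have hQ : quarticLaw p β h m 0 0 = quarticTilt (-iteratedDeriv 4 (H p β h) m / 24) 0 := by
    rw [quarticLaw_eq, zero_mul, zero_mul]
  have hk : 0 < p * |m ^ (p - 1)| := mul_pos hp0 (abs_pos.2 hm0)
  have := hprob 0
  obtain ⟨G, hG, hcdf⟩ := exists_measure_cdf_comp
    (continuous_cdf_of_singleton (quarticTilt_singleton
      (a := -iteratedDeriv 4 (H p β h) m / 24) 0))
    (M := fun t => quarticMean (-iteratedDeriv 4 (H p β h) m / 24) (t * p * |m ^ (p - 1)|))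
    ((continuous_quarticMean ha).comp (by fun_prop))
    ((monotone_quarticMean ha).comp fun s t hst => by
      simp only [mul_assoc]
      exact mul_le_mul_of_nonneg_right hst hk.le)
    ((tendsto_quarticMean_atTop ha).comp (by
      simp only [mul_assoc]
      exact tendsto_id.atTop_mul_const hk))
    ((tendsto_quarticMean_atBot ha).comp (by
      simp only [mul_assoc]
      exact tendsto_id.atBot_mul_const hk))
  have hcdf' : ∀ t : ℝ, cdf G t = cdf (quarticLaw p β h m 0 0)
      (Real.sign (m ^ (p - 1)) * ∫ u, u ∂(quarticLaw p β h m t 0)) := fun t => by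
    rw [hcdf, hmean, hQ]
  refine ⟨G, hG, hcdf', tendstoInDistribution_ereal (fun N => measurable_of_finite _) fun t => ?_⟩
  rw [hcdf']
  refine (tendsto_prob_pow_le hp hspecial hm t).congr' ?_
  -- From `N = 2` on the sufficient statistic is not constant, so the event for the estimate
  -- coincides with the event for the magnetization.
  filter_upwards [eventually_ge_atTop 2] with N hN
  congr 1
  ext x
  have hr : 0 < quarterRoot N ^ 3 := by
    have := one_le_quarterRoot (by omega : 1 ≤ N)
    positivity
  rw [Set.mem_ofPred_eq, Set.mem_ofPred_eq, ← quarterRoot_pow_three, coe_mul_sub_le_iff hr,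
    (hbetaHat N x).le_iff (by omega) hN]
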